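/- **Setting.** A *concurrent program* $\mathcal P$ consists of finitely many processes, finitely many shared variables and a finite data domain. Each process has a finite set of local states and a set of transitions $s \xrightarrow{\mathsf{instr}} s'$, where an instruction is a read $\mathrm{rd}(x,d)$, a write $\mathrm{wr}(x,d)$, an atomic read-write $\mathrm{arw}(x,d,d')$, a skip $\mathrm{nop}$ or a memory fence $\mathrm{mf}$. A *TSO configuration* consists of the local states, one FIFO store buffer of pending writes per process, and the memory. A write appends $(x,d)$ to the process's own buffer; a read $\mathrm{rd}(x,d)$ is enabled if the newest pending write on $x$ in the own buffer has value $d$ or, when there is none, the memory value of $x$ is $d$; $\mathrm{mf}$ and $\mathrm{arw}(x,d,d')$ require the own buffer to be empty, and $\mathrm{arw}(x,d,d')$ moreover requires that the memory value of $x$ is $d$ and changes it to $d'$. An *update* removes the oldest pending write $(x,d)$ from some buffer and stores $d$ in the memory variable $x$. In a *safety game* every configuration is owned by player A or player B and has a successor (the game is deadlock-free). The owner of the current configuration chooses the next one. Player B wins an infinite play if it visits a final configuration, otherwise player A wins. A configuration is *winning* for a player if she has a strategy from it that wins against all strategies of the opponent. For a program $\mathcal P$ and a set $F$ of final local states, the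 *AB-TSO game* has as configurations the pairs $c_p$ of a TSO configuration $c$ and a player $p\in\{A,B\}$, who owns it. A move of $p$ leads from $c_p$ to $c'_{p'}$, where $p'$ is the other player and $c'$ arises from $c$ by one instruction of one process followed by any number (possibly zero) of updates. The final configurations are the $c_A$ in which some process is in a local state of $F$. The *safety problem for the AB-TSO game* is: given a finite program $\mathcal P$ and a set $F$ whose AB-TSO game is deadlock-free, and a configuration of that game, decide whether the configuration is winning for player A. A *perfect channel system* $\mathcal L=(Q,M,\Delta)$ has a finite set $Q$ of states, a finite set $M$ of messages and transitions $\Delta\subseteq Q\times\{!m,?m,\mathrm{nop}\mid m\in M\}\times Q$. It operates on one unbounded FIFO channel: $!m$ appends $m$, $?m$ removes $m$ if it is the oldest message, and $\mathrm{nop}$ leaves the channel unchanged. Let $Q_F\subseteq Q$ and $q_0\in Q$. Define a program $\mathcal P$ with two processes, variables $x_w,x_r,y$ and data domain $M\uplus\{0,1,\bot,\top\}$ as follows ($m,m'$ range over $M$). * *Process 1* has the states of $Q$, a separate auxiliary state $h_t$ for each $t\in\Delta$, and states $h_L,h_F$. For $t=(q,\mathrm{nop},q')$: $q\xrightarrow{\mathrm{nop}}h_t\xrightarrow{\mathrm{nop}}q'$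 and $h_t\xrightarrow{\mathrm{rd}(x_r,m')}h_L$. For $t=(q,!m,q')$: $q\xrightarrow{\mathrm{wr}(x_w,m)}h_t\xrightarrow{\mathrm{wr}(y,1)}q'$ and $h_t\xrightarrow{\mathrm{rd}(x_r,m')}h_L$. For $t=(q,?m,q')$: $q\xrightarrow{\mathrm{rd}(x_r,m)}h_t\xrightarrow{\mathrm{rd}(x_r,\bot)}q'$. For $q\in Q_F$: $q\xrightarrow{\mathrm{wr}(x_w,\top)}h_F$. Moreover $h_L$ and $h_F$ have $\mathrm{nop}$ self-loops. * *Process 2* has the states $s_1,s_2,s_m\,(m\in M),s_4,\dots,s_{12},s_F,s_L$. Main cycle: $s_1\xrightarrow{\mathrm{nop}}s_2\xrightarrow{\mathrm{rd}(x_w,m)}s_m\xrightarrow{\mathrm{wr}(x_r,m)}s_4\xrightarrow{\mathrm{wr}(x_w,\bot)}s_5\xrightarrow{\mathrm{nop}}s_6\xrightarrow{\mathrm{mf}}s_7\xrightarrow{\mathrm{nop}}s_8\xrightarrow{\mathrm{wr}(y,0)}s_9\xrightarrow{\mathrm{nop}}s_{10}\xrightarrow{\mathrm{mf}}s_{11}\xrightarrow{\mathrm{wr}(x_r,\bot)}s_{12}\xrightarrow{\mathrm{nop}}s_1$.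 To $s_F$: from $s_1,s_8,s_{10},s_{12}$ by $\mathrm{rd}(x_w,m)$; from $s_1$ by $\mathrm{rd}(x_w,\top)$; from $s_2,s_4$ by $\mathrm{nop}$; from $s_m,s_5,s_6$ by $\mathrm{rd}(y,1)$; from $s_8$ by $\mathrm{rd}(y,0)$. To $s_L$: from $s_1,s_9,s_{11},s_{12}$ by $\mathrm{rd}(x_w,m)$; from $s_2$ by $\mathrm{rd}(x_w,\bot)$; from $s_2,s_4,s_5,s_7$ by $\mathrm{rd}(y,1)$; from $s_m,s_6,s_{10}$ by $\mathrm{nop}$. Moreover $s_F$ and $s_L$ have $\mathrm{nop}$ self-loops. **Theorem.** 1. For all $\mathcal L$, $Q_F$ and $q_0$ as above, the AB-TSO game of $\mathcal P$ with the single final local state $s_F$ is deadlock-free, and some state of $Q_F$ is reachable in $\mathcal L$ from $q_0$ with empty channel if and only if player B wins this game from the configuration, owned by player B, with local states $(q_0,s_1)$, empty buffers and memory $x_w\mapsto\bot$, $x_r\mapsto\bot$, $y\mapsto 0$. 2. The safety problem for the AB-TSO game is undecidable. -/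

import Mathlib

/-! ## Safety games -/

inductive Player where
  | A
  | B
  deriving DecidableEq

/-- The player who is not `p`. -/
def Player.other : Player → Player
  | .A => .B
  | .B => .A

/-- The data of a safety game: every configuration is owned by one of the two players, and the
final configurations, which player B tries to reach, are owned by player A. -/
structure SafetyGame where
  Conf : Type
  owner : Conf → Player
  move : Conf → Conf → Prop
  final : Set Conf
  final_owner : ∀ c ∈ final, owner c = Player.A

namespace SafetyGame

variable (G : SafetyGame)

/-- Every configuration has a successor (required of every safety game). -/
def DeadlockFree : Prop := ∀ c, ∃ c', G.move c c'

/-- A (not necessarily positional) strategy of player `p`: after every finite path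
`past ++ [c]` of the game that ends in a configuration `c` of `p`, it picks a successor of `c`.
Its values on other arguments are irrelevant. -/
structure Strategy (p : Player) where
  next : List G.Conf → G.Conf → G.Conf
  legal : ∀ past c, List.IsChain G.move (past ++ [c]) → G.owner c = p → G.move c (next past c)

variable {G}

/-- The first `n` configurations of the play induced by two strategies from `c₀`, together with
the configuration that comes next. -/
def run (c₀ : G.Conf) (σA : G.Strategy .A) (σB : G.Strategy .B) : ℕ → List G.Conf × G.Conf
  | 0 => ([], c₀)
  | n + 1 =>
    let past := (run c₀ σA σB n).1
    let c := (run c₀ σA σB n).2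
    (past ++ [c], match G.owner c with
      | .A => σA.next past c
      | .B => σB.next past c)

/-- The play induced by two strategies from `c₀`. -/
def play (c₀ : G.Conf) (σA : G.Strategy .A) (σB : G.Strategy .B) (n : ℕ) : G.Conf :=
  (run c₀ σA σB n).2

variable (G)

/-- `c` is winning for player A: she has a strategy with which no play from `c` is ever final. -/
def WinsA (c : G.Conf) : Prop :=
  ∃ σA : G.Strategy .A, ∀ σB : G.Strategy .B, ∀ n, play c σA σB n ∉ G.final

/-- `c` is winning for player B: she has a strategy that forces every play from `c` into the
final configurations. -/
def WinsB (c : G.Conf) : Prop :=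
  ∃ σB : G.Strategy .B, ∀ σA : G.Strategy .A, ∃ n, play c σA σB n ∈ G.final

end SafetyGame

/-! ## Concurrent programs and their TSO semantics -/

/-- Instructions over shared variables `X` with values in `D`. -/
inductive Instr (X D : Type) where
  | read (x : X) (d : D)
  | write (x : X) (d : D)
  | arw (x : X) (d d' : D)
  | nop
  | fence
  deriving DecidableEq

/-- Renaming of variables and values. -/
def Instr.map {X D X' D' : Type} (f : X → X') (g : D → D') : Instr X D → Instr X' D'
  | .read x d => .read (f x) (g d)
  | .write x d => .write (f x) (g d)
  | .arw x d d' => .arw (f x) (g d) (g d')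
  | .nop => .nop
  | .fence => .fence

/-- A concurrent program with process identifiers `I`, shared variables `X`, data domain `D`, and
local states `S i` of process `i`, is given by the transition relation of each process. All of
these types are finite wherever programs are used. -/
structure Program (I X D : Type) (S : I → Type) where
  trans : (i : I) → Set (S i × Instr X D × S i)

/-- A TSO configuration: local states, store buffers, memory. New writes enter a buffer at the
left end of the list; the oldest write is the rightmost one. -/
structure TSOConf (I X D : Type) (S : I → Type) where
  state : (i : I) → S i
  buffer : I → List (X × D)
  memory : X → D

section TSO

variable {I X D : Type} {S : I → Type} [DecidableEq I] [DecidableEq X]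

/-- The pending writes on variable `x`, newest first. -/
def pendingOn (x : X) (b : List (X × D)) : List (X × D) := b.filter fun m => m.1 = x

/-- One instruction of process `i` (all rules of the TSO semantics except updates). -/
inductive InstrStep (P : Program I X D S) : TSOConf I X D S → TSOConf I X D S → Prop
  | readOwnWrite {c : TSOConf I X D S} (i : I) {x : X} {d : D} {s' : S i} {w : List (X × D)} :
      (c.state i, .read x d, s') ∈ P.trans i → pendingOn x (c.buffer i) = (x, d) :: w →
      InstrStep P c ⟨Function.update c.state i s', c.buffer, c.memory⟩
  | readFromMemory {c : TSOConf I X D S} (i : I) {x : X} {d : D} {s' : S i} :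
      (c.state i, .read x d, s') ∈ P.trans i → pendingOn x (c.buffer i) = [] →
      c.memory x = d →
      InstrStep P c ⟨Function.update c.state i s', c.buffer, c.memory⟩
  | write {c : TSOConf I X D S} (i : I) {x : X} {d : D} {s' : S i} :
      (c.state i, .write x d, s') ∈ P.trans i →
      InstrStep P c ⟨Function.update c.state i s',
        Function.update c.buffer i ((x, d) :: c.buffer i), c.memory⟩
  | arw {c : TSOConf I X D S} (i : I) {x : X} {d d' : D} {s' : S i} :
      (c.state i, .arw x d d', s') ∈ P.trans i → c.buffer i = [] → c.memory x = d →
      InstrStep P c ⟨Function.update c.state i s', c.buffer, Function.update c.memory x d'⟩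
  | skip {c : TSOConf I X D S} (i : I) {s' : S i} :
      (c.state i, .nop, s') ∈ P.trans i →
      InstrStep P c ⟨Function.update c.state i s', c.buffer, c.memory⟩
  | fence {c : TSOConf I X D S} (i : I) {s' : S i} :
      (c.state i, .fence, s') ∈ P.trans i → c.buffer i = [] →
      InstrStep P c ⟨Function.update c.state i s', c.buffer, c.memory⟩

/-- One buffer update: the oldest pending write of some process reaches the memory. -/
inductive UpdateStep : TSOConf I X D S → TSOConf I X D S → Prop
  | update {c : TSOConf I X D S} (i : I) {x : X} {d : D} {w : List (X × D)} :
      c.buffer i = w ++ [(x, d)] →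
      UpdateStep c ⟨c.state, Function.update c.buffer i w, Function.update c.memory x d⟩

/-- The AB-TSO game: the players alternate; a move is one instruction of some process followed by
any number (possibly zero) of buffer updates. The configuration `(p, c)` is owned by `p`. It is
final if `p` is player A and some process is in one of its final local states. -/
def abtsoGame (P : Program I X D S) (F : (i : I) → Set (S i)) : SafetyGame where
  Conf := Player × TSOConf I X D S
  owner g := g.1
  move g g' := g'.1 = g.1.other ∧
    ∃ c, InstrStep P g.2 c ∧ Relation.ReflTransGen UpdateStep c g'.2
  final := {g | g.1 = Player.A ∧ ∃ i, g.2.state i ∈ F i}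
  final_owner _ h := h.1

end TSO

/-! ## Perfect channel systems -/

inductive ChannelOp (M : Type) where
  | send (m : M)
  | recv (m : M)
  | nop

/-- A perfect channel system with states `Q` and messages `M`. -/
structure PCS (Q M : Type) where
  trans : Set (Q × ChannelOp M × Q)

namespace PCS

variable {Q M : Type} (L : PCS Q M)

/-- Configurations are pairs of a state and a channel content. The newest message is at the left
end of the channel, the oldest one at the right end. -/
inductive Step : Q × List M → Q × List M → Prop
  | send {q q' : Q} {m : M} {w : List M} :
      (q, .send m, q') ∈ L.trans → Step (q, w) (q', m :: w)
  | recv {q q' : Q} {m : M} {w : List M} :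
      (q, .recv m, q') ∈ L.trans → Step (q, w ++ [m]) (q', w)
  | nop {q q' : Q} {w : List M} :
      (q, .nop, q') ∈ L.trans → Step (q, w) (q', w)

/-- Some state of `QF` is reachable from `q₀` with empty channel. -/
def Reaches (q₀ : Q) (QF : Set Q) : Prop :=
  ∃ q ∈ QF, ∃ w, Relation.ReflTransGen L.Step (q₀, []) (q, w)

end PCS

/-! ## The program that simulates a perfect channel system in the AB-TSO game -/

/-- The two processes. -/
inductive SimProc where
  | p1
  | p2
  deriving DecidableEq

/-- The shared variables. -/
inductive SimVar where
  | xw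
  | xr
  | y
  deriving DecidableEq

/-- The data domain. -/
inductive SimVal (M : Type) where
  | msg (m : M)
  | zero
  | one
  | bot
  | top

/-- Local states of the first process: the states of the channel system, a separate auxiliary
state for each of its transitions, and two sinks. -/
inductive SimState1 {Q M : Type} (L : PCS Q M) where
  | chan (q : Q)
  | aux (t : L.trans)
  | hL
  | hF

/-- Local states of the second process. -/
inductive SimState2 (M : Type) where
  | s1
  | s2
  | sm (m : M)
  | s4
  | s5
  | s6
  | s7
  | s8
  | s9
  | s10
  | s11
  | s12
  | sF
  | sL

abbrev SimState {Q M : Type} (L : PCS Q M) : SimProc → Type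
  | .p1 => SimState1 L
  | .p2 => SimState2 M

section Simulation

variable {Q M : Type}

open SimVar SimVal

/-- Transitions of the first process. -/
inductive SimTrans1 (L : PCS Q M) (QF : Set Q) :
    SimState1 L → Instr SimVar (SimVal M) → SimState1 L → Prop
  | nop_fst {q q' : Q} (h : (q, .nop, q') ∈ L.trans) :
      SimTrans1 L QF (.chan q) .nop (.aux ⟨_, h⟩)
  | nop_snd {q q' : Q} (h : (q, .nop, q') ∈ L.trans) :
      SimTrans1 L QF (.aux ⟨_, h⟩) .nop (.chan q')
  | nop_lose {q q' : Q} (h : (q, .nop, q') ∈ L.trans) (m' : M) :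
      SimTrans1 L QF (.aux ⟨_, h⟩) (.read xr (msg m')) .hL
  | send_fst {q q' : Q} {m : M} (h : (q, .send m, q') ∈ L.trans) :
      SimTrans1 L QF (.chan q) (.write xw (msg m)) (.aux ⟨_, h⟩)
  | send_snd {q q' : Q} {m : M} (h : (q, .send m, q') ∈ L.trans) :
      SimTrans1 L QF (.aux ⟨_, h⟩) (.write y one) (.chan q')
  | send_lose {q q' : Q} {m : M} (h : (q, .send m, q') ∈ L.trans) (m' : M) :
      SimTrans1 L QF (.aux ⟨_, h⟩) (.read xr (msg m')) .hL
  | recv_fst {q q' : Q} {m : M} (h : (q, .recv m, q') ∈ L.trans) :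
      SimTrans1 L QF (.chan q) (.read xr (msg m)) (.aux ⟨_, h⟩)
  | recv_snd {q q' : Q} {m : M} (h : (q, .recv m, q') ∈ L.trans) :
      SimTrans1 L QF (.aux ⟨_, h⟩) (.read xr bot) (.chan q')
  | loop_hL : SimTrans1 L QF .hL .nop .hL
  | finish {q : Q} (h : q ∈ QF) : SimTrans1 L QF (.chan q) (.write xw top) .hF
  | loop_hF : SimTrans1 L QF .hF .nop .hF

/-- Transitions of the second process: the main cycle, the transitions to the final state `sF`,
and the transitions to the sink `sL`. -/
inductive SimTrans2 (M : Type) : SimState2 M → Instr SimVar (SimVal M) → SimState2 M → Prop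
  | main1 : SimTrans2 M .s1 .nop .s2
  | main2 (m : M) : SimTrans2 M .s2 (.read xw (msg m)) (.sm m)
  | main3 (m : M) : SimTrans2 M (.sm m) (.write xr (msg m)) .s4
  | main4 : SimTrans2 M .s4 (.write xw bot) .s5
  | main5 : SimTrans2 M .s5 .nop .s6
  | main6 : SimTrans2 M .s6 .fence .s7
  | main7 : SimTrans2 M .s7 .nop .s8
  | main8 : SimTrans2 M .s8 (.write y zero) .s9
  | main9 : SimTrans2 M .s9 .nop .s10
  | main10 : SimTrans2 M .s10 .fence .s11
  | main11 : SimTrans2 M .s11 (.write xr bot) .s12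
  | main12 : SimTrans2 M .s12 .nop .s1
  | final1 (m : M) : SimTrans2 M .s1 (.read xw (msg m)) .sF
  | final1' : SimTrans2 M .s1 (.read xw top) .sF
  | final2 : SimTrans2 M .s2 .nop .sF
  | final3 (m : M) : SimTrans2 M (.sm m) (.read y one) .sF
  | final4 : SimTrans2 M .s4 .nop .sF
  | final5 : SimTrans2 M .s5 (.read y one) .sF
  | final6 : SimTrans2 M .s6 (.read y one) .sF
  | final8 : SimTrans2 M .s8 (.read y zero) .sF
  | final8' (m : M) : SimTrans2 M .s8 (.read xw (msg m)) .sF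
  | final10 (m : M) : SimTrans2 M .s10 (.read xw (msg m)) .sF
  | final12 (m : M) : SimTrans2 M .s12 (.read xw (msg m)) .sF
  | loop_sF : SimTrans2 M .sF .nop .sF
  | lose1 (m : M) : SimTrans2 M .s1 (.read xw (msg m)) .sL
  | lose2 : SimTrans2 M .s2 (.read xw bot) .sL
  | lose2' : SimTrans2 M .s2 (.read y one) .sL
  | lose3 (m : M) : SimTrans2 M (.sm m) .nop .sL
  | lose4 : SimTrans2 M .s4 (.read y one) .sL
  | lose5 : SimTrans2 M .s5 (.read y one) .sL
  | lose6 : SimTrans2 M .s6 .nop .sL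
  | lose7 : SimTrans2 M .s7 (.read y one) .sL
  | lose9 (m : M) : SimTrans2 M .s9 (.read xw (msg m)) .sL
  | lose10 : SimTrans2 M .s10 .nop .sL
  | lose11 (m : M) : SimTrans2 M .s11 (.read xw (msg m)) .sL
  | lose12 (m : M) : SimTrans2 M .s12 (.read xw (msg m)) .sL
  | loop_sL : SimTrans2 M .sL .nop .sL

/-- The program consisting of the two processes. -/
def simProgram (L : PCS Q M) (QF : Set Q) : Program SimProc SimVar (SimVal M) (SimState L) where
  trans
    | .p1 => {t | SimTrans1 L QF t.1 t.2.1 t.2.2}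
    | .p2 => {t | SimTrans2 M t.1 t.2.1 t.2.2}

/-- The only final local state is `sF` of the second process. -/
def simFinal (L : PCS Q M) : (i : SimProc) → Set (SimState L i)
  | .p1 => (∅ : Set (SimState1 L))
  | .p2 => ({SimState2.sF} : Set (SimState2 M))

/-- The initial TSO configuration: local states `q₀` and `s1`, empty buffers, and memory
`xw ↦ ⊥`, `xr ↦ ⊥`, `y ↦ 0`. -/
def simInit (L : PCS Q M) (q₀ : Q) : TSOConf SimProc SimVar (SimVal M) (SimState L) where
  state
    | .p1 => (SimState1.chan q₀ : SimState1 L)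
    | .p2 => (SimState2.s1 : SimState2 M)
  buffer _ := []
  memory
    | .xw => bot
    | .xr => bot
    | .y => zero

end Simulation

/-! ## Instances of the safety problem as finite data -/

instance : Primcodable Player :=
  Primcodable.ofEquiv Bool
    { toFun := fun p => match p with
        | .A => true
        | .B => false
      invFun := fun b => match b with
        | true => .A
        | false => .B
      left_inv := by rintro (_ | _) <;> rfl
      right_inv := by rintro (_ | _) <;> rfl }

/-- Instructions as elements of a sum of products. -/
def instrEquiv (X D : Type) : Instr X D ≃ (X × D) ⊕ (X × D) ⊕ (X × D × D) ⊕ Bool where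
  toFun
    | .read x d => .inl (x, d)
    | .write x d => .inr (.inl (x, d))
    | .arw x d d' => .inr (.inr (.inl (x, d, d')))
    | .nop => .inr (.inr (.inr true))
    | .fence => .inr (.inr (.inr false))
  invFun
    | .inl (x, d) => .read x d
    | .inr (.inl (x, d)) => .write x d
    | .inr (.inr (.inl (x, d, d'))) => .arw x d d'
    | .inr (.inr (.inr true)) => .nop
    | .inr (.inr (.inr false)) => .fence
  left_inv := by rintro (_ | _ | _ | _ | _) <;> rfl
  right_inv := by rintro (_ | _ | _ | _ | _) <;> rfl

instance : Primcodable (Instr ℕ ℕ) := Primcodable.ofEquiv _ (instrEquiv ℕ ℕ)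

/-- An instance of the safety problem, written as finite data. Processes, local states, variables
and values are numbered from `0`. A process is given by its number of local states and the list of
its transitions, a final local state by the numbers of its process and of the state. The last four
fields describe a game configuration. -/
structure SafetyInstance where
  numVars : ℕ
  numVals : ℕ
  procs : List (ℕ × List (ℕ × Instr ℕ ℕ × ℕ))
  finals : List (ℕ × ℕ)
  turn : Player
  states : List ℕ
  buffers : List (List (ℕ × ℕ))
  memory : List ℕ

/-- Safety instances as tuples. -/
def safetyInstanceEquiv : SafetyInstance ≃
    ℕ × ℕ × List (ℕ × List (ℕ × Instr ℕ ℕ × ℕ)) × List (ℕ × ℕ) × Player × List ℕ ×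
      List (List (ℕ × ℕ)) × List ℕ where
  toFun k := (k.numVars, k.numVals, k.procs, k.finals, k.turn, k.states, k.buffers, k.memory)
  invFun t := ⟨t.1, t.2.1, t.2.2.1, t.2.2.2.1, t.2.2.2.2.1, t.2.2.2.2.2.1, t.2.2.2.2.2.2.1,
    t.2.2.2.2.2.2.2⟩
  left_inv _ := rfl
  right_inv _ := rfl

instance : Primcodable SafetyInstance := Primcodable.ofEquiv _ safetyInstanceEquiv

namespace SafetyInstance

variable (k : SafetyInstance)

/-- Process identifiers. -/
abbrev Proc : Type := Fin k.procs.length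

/-- Local states of process `i`. -/
abbrev LocalState (i : k.Proc) : Type := Fin (k.procs.get i).1

/-- The finite program described by the instance. -/
def program : Program k.Proc (Fin k.numVars) (Fin k.numVals) k.LocalState where
  trans i := {t | (t.1.val, t.2.1.map Fin.val Fin.val, t.2.2.val) ∈ (k.procs.get i).2}

/-- The final local states described by the instance. -/
def finalStates (i : k.Proc) : Set (k.LocalState i) := {s | (i.val, s.val) ∈ k.finals}

/-- The AB-TSO game described by the instance. -/
abbrev game : SafetyGame := abtsoGame k.program k.finalStates

/-- No transition and no final state mentions a number that is out of range. -/
def InRange : Prop :=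
  (∀ i : k.Proc, ∀ t ∈ (k.procs.get i).2, ∃ t' ∈ k.program.trans i,
    t = (t'.1.val, t'.2.1.map Fin.val Fin.val, t'.2.2.val)) ∧
  ∀ f ∈ k.finals, ∃ i : k.Proc, ∃ s : k.LocalState i, f = (i.val, s.val)

/-- The last fields of the instance describe the TSO configuration `c`. -/
def Represents (c : TSOConf k.Proc (Fin k.numVars) (Fin k.numVals) k.LocalState) : Prop :=
  (k.states = List.ofFn fun i => (c.state i).val) ∧
  (k.buffers = List.ofFn fun i => (c.buffer i).map fun m => (m.1.val, m.2.val)) ∧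
  (k.memory = List.ofFn fun x => (c.memory x).val)

/-- The instance describes a (deadlock-free) AB-TSO game and its configuration `(k.turn, c)`. -/
def IsValid (c : TSOConf k.Proc (Fin k.numVars) (Fin k.numVals) k.LocalState) : Prop :=
  k.InRange ∧ k.Represents c ∧ k.game.DeadlockFree

end SafetyInstance

/-- The safety problem for the AB-TSO game is decidable: some algorithm halts on every instance
that describes a game and a configuration, and answers whether the configuration is winning for
player A. Nothing is asked of the algorithm on other inputs. -/
def ABTSOSafetyDecidable : Prop :=
  ∃ f : SafetyInstance →. Bool, Partrec f ∧
    ∀ k c, k.IsValid c → ∃ b ∈ f k, (b = true ↔ k.game.WinsA (k.turn, c))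

/-! In a deadlock-free safety game player B wins exactly from the attractor `Attr` of the final
configurations, and player A from its complement (`DeadlockFree.winsB_iff`,
`DeadlockFree.winsA_iff`). Both parts of the theorem thus become statements about `Attr`.

Part 1. The store buffer of process 1 is the channel: a message `m` is a pending write of `m` to
`xw` followed by a pending `1` for `y` (`bufferOf`). Between two simulated transitions player B is
to move, process 1 is in a state of the channel system, process 2 is in `s1`, and the memory is `⊥,
⊥, 0`. A nop or a send is begun by B in process 1 and completed by A. For a receive, one update
brings the oldest message to `xw`, process 2 copies it to `xr`, where process 1 reads it; later one
update brings the `1` behind it to `y`, and process 2 resets the variables. Messages and ones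
alternate in the buffer, so an untimely update leaves a message in `xw` or a `1` in `y`, and the
opponent of the player who caused it can take process 2 to `sF` or to `sL`. The remaining deviations
are either disabled or answered in the same way. Hence B can force the simulation of a run into `QF`
(`attr_of_reachesFrom`), and if there is no such run, A stays in the trap formed by `SafeA` and
`SafeB` (`not_attr_of_not_reachesFrom`). The resulting equivalence `attr_iff_reachesFrom` holds for
every channel content, which part 2 needs.

Part 2. A partial recursive function with undecidable domain is evaluated by a fixed machine with
several stacks. The stacks, each behind its own separator, are written into the channel as one
cyclic word; the channel system rotates the word until the separator of the wanted stack is in front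
and then edits the top of that stack. This gives a fixed finite channel system for which
reachability is undecidable in the initial channel content (`exists_undecidable_pcs`). Numbering the
constituents of its program is a bisimulation of games (`Renaming.attr_iff`). Only one store buffer
of the resulting instance depends on the input, so the reduction is computable. -/

/-! ### Attractors and positional determinacy of safety games -/

namespace SafetyGame

variable {G : SafetyGame}

/-- The configurations from which player B can force a visit to a final configuration. -/
inductive Attr (G : SafetyGame) : G.Conf → Prop
  | final {c : G.Conf} : c ∈ G.final → Attr G c
  | some_move {c c' : G.Conf} : G.owner c = .B → G.move c c' → Attr G c' → Attr G c
  | all_moves {c : G.Conf} : G.owner c = .A → (∀ c', G.move c c' → Attr G c') → Attr G c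

/-- The attractor graded by ordinals. -/
inductive AttrAt (G : SafetyGame) : Ordinal.{0} → G.Conf → Prop
  | final {o : Ordinal} {c : G.Conf} : c ∈ G.final → AttrAt G o c
  | some_move {o o' : Ordinal} {c c' : G.Conf} : G.owner c = .B → G.move c c' → o' < o →
      AttrAt G o' c' → AttrAt G o c
  | all_moves {o : Ordinal} {c : G.Conf} (r : G.Conf → Ordinal) : G.owner c = .A →
      (∀ c', G.move c c' → r c' < o) → (∀ c', G.move c c' → AttrAt G (r c') c') → AttrAt G o c

theorem Attr.exists_attrAt {c : G.Conf} (h : G.Attr c) : ∃ o, G.AttrAt o c := by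
  induction h with
  | final h => exact ⟨0, .final h⟩
  | some_move ho hm _ ih =>
    obtain ⟨o, ih⟩ := ih
    exact ⟨Order.succ o, .some_move ho hm (Order.lt_succ o) ih⟩
  | @all_moves c ho _ ih =>
    classical
    choose! r hr using ih
    -- Player A may have infinitely many moves, so natural numbers would not suffice as grades; the
    -- successor of the supremum exceeds the grades of all of them.
    refine ⟨Order.succ (⨆ c', r c'), .all_moves r ho (fun c' _ => ?_) hr⟩
    exact Order.lt_succ_of_le (Ordinal.le_iSup r c')

theorem AttrAt.attr {o : Ordinal} {c : G.Conf} (h : G.AttrAt o c) : G.Attr c := by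
  induction h with
  | final h => exact .final h
  | some_move ho hm _ _ ih => exact .some_move ho hm ih
  | all_moves r ho _ _ ih => exact .all_moves ho ih

/-- The least grade of a configuration. -/
noncomputable def attrRank (G : SafetyGame) (c : G.Conf) : Ordinal.{0} := sInf {o | G.AttrAt o c}

theorem Attr.attrAt_rank {c : G.Conf} (h : G.Attr c) : G.AttrAt (G.attrRank c) c :=
  csInf_mem (s := {o | G.AttrAt o c}) h.exists_attrAt

theorem AttrAt.rank_le {o : Ordinal} {c : G.Conf} (h : G.AttrAt o c) : G.attrRank c ≤ o :=
  csInf_le' h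

theorem Attr.exists_move_rank_lt {c : G.Conf} (h : G.Attr c) (hf : c ∉ G.final)
    (ho : G.owner c = .B) : ∃ c', G.move c c' ∧ G.Attr c' ∧ G.attrRank c' < G.attrRank c := by
  cases h.attrAt_rank with
  | final h => exact absurd h hf
  | some_move _ hm hlt h' => exact ⟨_, hm, h'.attr, h'.rank_le.trans_lt hlt⟩
  | all_moves _ ho' => simp [ho] at ho'

theorem Attr.rank_lt_of_move {c c' : G.Conf} (h : G.Attr c) (hf : c ∉ G.final)
    (ho : G.owner c = .A) (hm : G.move c c') : G.Attr c' ∧ G.attrRank c' < G.attrRank c := by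
  cases h.attrAt_rank with
  | final h => exact absurd h hf
  | some_move ho' => simp [ho] at ho'
  | all_moves r _ hlt h' => exact ⟨(h' c' hm).attr, (h' c' hm).rank_le.trans_lt (hlt c' hm)⟩

theorem move_run (c₀ : G.Conf) (σA : G.Strategy .A) (σB : G.Strategy .B) (n : ℕ)
    (h : List.IsChain G.move ((run c₀ σA σB n).1 ++ [(run c₀ σA σB n).2])) :
    G.move (run c₀ σA σB n).2 (run c₀ σA σB (n + 1)).2 := by
  simp only [run]
  split
  · exact σA.legal _ _ h (by assumption)
  · exact σB.legal _ _ h (by assumption)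

/-- Strategies are legal only on genuine paths, so that the history is a path has to be proved along
with the legality of each new move. -/
theorem isChain_run (c₀ : G.Conf) (σA : G.Strategy .A) (σB : G.Strategy .B) (n : ℕ) :
    List.IsChain G.move ((run c₀ σA σB n).1 ++ [(run c₀ σA σB n).2]) := by
  induction n with
  | zero => simp [run]
  | succ n ih =>
    have hm := move_run c₀ σA σB n ih
    have : (run c₀ σA σB (n + 1)).1 = (run c₀ σA σB n).1 ++ [(run c₀ σA σB n).2] := rfl
    rw [this, List.isChain_append]
    refine ⟨ih, List.isChain_singleton _, ?_⟩
    simpa using hm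

theorem move_play (c₀ : G.Conf) (σA : G.Strategy .A) (σB : G.Strategy .B) (n : ℕ) :
    G.move (play c₀ σA σB n) (play c₀ σA σB (n + 1)) :=
  move_run c₀ σA σB n (isChain_run c₀ σA σB n)

/-- The strategy that moves by `f`. -/
def Strategy.positional {p : Player} (f : G.Conf → G.Conf)
    (hf : ∀ c, G.owner c = p → G.move c (f c)) : G.Strategy p where
  next _ := f
  legal _ c _ ho := hf c ho

theorem play_succ_positional_A {c₀ : G.Conf} {f : G.Conf → G.Conf}
    {hf : ∀ c, G.owner c = .A → G.move c (f c)} {σB : G.Strategy .B} {n : ℕ}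
    (ho : G.owner (play c₀ (.positional f hf) σB n) = .A) :
    play c₀ (.positional f hf) σB (n + 1) = f (play c₀ (.positional f hf) σB n) := by
  unfold play at ho ⊢
  simp only [run, ho]
  rfl

theorem play_succ_positional_B {c₀ : G.Conf} {f : G.Conf → G.Conf}
    {hf : ∀ c, G.owner c = .B → G.move c (f c)} {σA : G.Strategy .A} {n : ℕ}
    (ho : G.owner (play c₀ σA (.positional f hf) n) = .B) :
    play c₀ σA (.positional f hf) (n + 1) = f (play c₀ σA (.positional f hf) n) := by
  unfold play at ho ⊢
  simp only [run, ho]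
  rfl

/-- Player B always moves to a configuration of smaller rank, and every move of player A decreases
the rank too. Ordinals are well-founded, so a final configuration is reached. -/
theorem DeadlockFree.winsB_of_attr (hG : G.DeadlockFree) {c : G.Conf} (h : G.Attr c) :
    G.WinsB c := by
  classical
  have key : ∀ c, ∃ c', G.move c c' ∧ (G.Attr c → c ∉ G.final → G.owner c = .B →
      G.Attr c' ∧ G.attrRank c' < G.attrRank c) := by
    intro c
    by_cases hc : G.Attr c ∧ c ∉ G.final ∧ G.owner c = .B
    · obtain ⟨c', hm, h'⟩ := hc.1.exists_move_rank_lt hc.2.1 hc.2.2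
      exact ⟨c', hm, fun _ _ _ => h'⟩
    · obtain ⟨c', hm⟩ := hG c
      exact ⟨c', hm, fun h1 h2 h3 => absurd ⟨h1, h2, h3⟩ hc⟩
  choose f hf hf' using key
  refine ⟨.positional f fun c _ => hf c, fun σA => ?_⟩
  set σB : G.Strategy .B := .positional f fun c _ => hf c
  suffices H : ∀ o : Ordinal, ∀ n, G.Attr (play c σA σB n) → G.attrRank (play c σA σB n) = o →
      ∃ m, play c σA σB m ∈ G.final from H _ 0 h rfl
  intro o
  induction o using WellFoundedLT.induction with
  | ind o ih =>
    intro n hn hr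
    by_cases hfin : play c σA σB n ∈ G.final
    · exact ⟨n, hfin⟩
    have : G.Attr (play c σA σB (n + 1)) ∧
        G.attrRank (play c σA σB (n + 1)) < G.attrRank (play c σA σB n) := by
      cases ho : G.owner (play c σA σB n) with
      | A => exact hn.rank_lt_of_move hfin ho (move_play ..)
      | B =>
        rw [play_succ_positional_B ho]
        exact hf' _ hn hfin ho
    exact ih _ (hr ▸ this.2) (n + 1) this.1 rfl

/-- Outside the attractor player A always has a move that stays outside, and no move of player B
leads inside. -/
theorem DeadlockFree.winsA_of_not_attr (hG : G.DeadlockFree) {c : G.Conf} (h : ¬ G.Attr c) :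
    G.WinsA c := by
  classical
  have key : ∀ c, ∃ c', G.move c c' ∧ (¬ G.Attr c → G.owner c = .A → ¬ G.Attr c') := by
    intro c
    by_cases hc : ¬ G.Attr c ∧ G.owner c = .A
    · by_contra! hcon
      exact hc.1 (.all_moves hc.2 fun c' hm => (hcon c' hm).2.2)
    · obtain ⟨c', hm⟩ := hG c
      exact ⟨c', hm, fun h1 h2 => absurd ⟨h1, h2⟩ hc⟩
  choose f hf hf' using key
  refine ⟨.positional f fun c _ => hf c, fun σB n hn => ?_⟩
  set σA : G.Strategy .A := .positional f fun c _ => hf c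
  suffices H : ∀ n, ¬ G.Attr (play c σA σB n) from H n (.final hn)
  intro n
  induction n with
  | zero => exact h
  | succ n ih =>
    cases ho : G.owner (play c σA σB n) with
    | A =>
      rw [play_succ_positional_A ho]
      exact hf' _ ih ho
    | B => exact fun h' => ih (.some_move ho (move_play ..) h')

theorem WinsA.not_winsB {c : G.Conf} (hA : G.WinsA c) : ¬ G.WinsB c := by
  rintro ⟨σB, hB⟩
  obtain ⟨σA, hA⟩ := hA
  obtain ⟨n, hn⟩ := hB σA
  exact hA σB n hn

theorem DeadlockFree.winsB_iff (hG : G.DeadlockFree) {c : G.Conf} : G.WinsB c ↔ G.Attr c :=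
  ⟨fun h => not_not.1 fun h' => (hG.winsA_of_not_attr h').not_winsB h, hG.winsB_of_attr⟩

theorem DeadlockFree.winsA_iff (hG : G.DeadlockFree) {c : G.Conf} : G.WinsA c ↔ ¬ G.Attr c :=
  ⟨fun h h' => h.not_winsB (hG.winsB_of_attr h'), hG.winsA_of_not_attr⟩

/-- A set of configurations in which player A can stay and which contains no final one is disjoint
from the attractor. -/
theorem not_attr_of_trap {W : Set G.Conf} (hfin : ∀ c ∈ W, c ∉ G.final)
    (hA : ∀ c ∈ W, G.owner c = .A → ∃ c' ∈ W, G.move c c')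
    (hB : ∀ c ∈ W, G.owner c = .B → ∀ c', G.move c c' → c' ∈ W) {c : G.Conf} (hc : c ∈ W) :
    ¬ G.Attr c := by
  intro h
  induction h with
  | final h => exact hfin _ hc h
  | some_move ho hm _ ih => exact ih (hB _ hc ho _ hm)
  | all_moves ho _ ih =>
    obtain ⟨c', hc', hm⟩ := hA _ hc ho
    exact ih c' hm hc'

/-- Attractors are preserved by bisimulations. -/
theorem attr_of_bisim {G' : SafetyGame} {R : G.Conf → G'.Conf → Prop}
    (howner : ∀ c c', R c c' → G.owner c = G'.owner c')
    (hfin : ∀ c c', R c c' → c ∈ G.final → c' ∈ G'.final)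
    (hforth : ∀ c c' d, R c c' → G.move c d → ∃ d', G'.move c' d' ∧ R d d')
    (hback : ∀ c c' d', R c c' → G'.move c' d' → ∃ d, G.move c d ∧ R d d')
    {c : G.Conf} {c' : G'.Conf} (hR : R c c') (h : G.Attr c) : G'.Attr c' := by
  induction h generalizing c' with
  | final h => exact .final (hfin _ _ hR h)
  | some_move ho hm _ ih =>
    obtain ⟨d', hm', hR'⟩ := hforth _ _ _ hR hm
    exact .some_move ((howner _ _ hR).symm.trans ho) hm' (ih hR')
  | all_moves ho _ ih =>
    refine .all_moves ((howner _ _ hR).symm.trans ho) fun d' hm' => ?_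
    obtain ⟨d, hm, hR'⟩ := hback _ _ _ hR hm'
    exact ih d hm hR'

end SafetyGame

/-! ### The effect of a sequence of updates -/

section Updates

variable {I X D : Type} {S : I → Type} [DecidableEq I] [DecidableEq X]

/-- The value of variable `z` after the writes `p` (newest first) to a memory in which it is `d`. -/
def valAfter (z : X) (p : List (X × D)) (d : D) : D :=
  ((pendingOn z p).head?.map Prod.snd).getD d

@[simp] theorem pendingOn_nil (z : X) : pendingOn z ([] : List (X × D)) = [] := rfl

@[simp] theorem valAfter_nil (z : X) (d : D) : valAfter z [] d = d := rfl

theorem pendingOn_cons (z x : X) (e : D) (p : List (X × D)) :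
    pendingOn z ((x, e) :: p) = if x = z then (x, e) :: pendingOn z p else pendingOn z p := by
  by_cases h : x = z <;> simp [pendingOn, h]

theorem valAfter_cons (z x : X) (e d : D) (p : List (X × D)) :
    valAfter z ((x, e) :: p) d = if x = z then e else valAfter z p d := by
  by_cases h : x = z <;> simp [valAfter, pendingOn_cons, h]

theorem pendingOn_append (z : X) (p p' : List (X × D)) :
    pendingOn z (p ++ p') = pendingOn z p ++ pendingOn z p' := by
  simp [pendingOn]

/-- Here `p i` is the part of the buffer of process `i` that has been flushed. On a variable that
only one process flushes, the newest of its flushed writes decides the value, however the updates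
are interleaved. Where several processes flush the same variable the order matters, and nothing is
claimed. -/
theorem updates_spec {c d : TSOConf I X D S} (h : Relation.ReflTransGen UpdateStep c d) :
    d.state = c.state ∧ ∃ p : I → List (X × D), (∀ i, c.buffer i = d.buffer i ++ p i) ∧
      ∀ z i, (∀ j, j ≠ i → pendingOn z (p j) = []) → d.memory z = valAfter z (p i) (c.memory z) := by
  induction h with
  | refl => exact ⟨rfl, fun _ => [], by simp, by simp⟩
  | @tail d e _ hstep ih =>
    obtain ⟨hs, p, hp, hm⟩ := ih
    cases hstep with
    | @update i x v w hb =>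
      refine ⟨hs, Function.update p i ((x, v) :: p i), fun j => ?_, fun z j hj => ?_⟩
      · by_cases hji : j = i
        · subst hji
          simp [hp, hb]
        · simp [hp, hji]
      · by_cases hji : j = i
        · subst hji
          have := hm z j fun k hk => by simpa [hk] using hj k hk
          by_cases hx : x = z
          · subst hx
            simp [valAfter_cons]
          · simp [valAfter_cons, hx, Function.update_of_ne (Ne.symm hx), this]
        · have hi := hj i (Ne.symm hji)
          rw [Function.update_self, pendingOn_cons] at hi
          split_ifs at hi with hx
          have := hm z j fun k hk => by
            by_cases hki : k = i
            · subst hki; exact hi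
            · simpa [hki] using hj k hk
          simp [hji, Function.update_of_ne (Ne.symm hx), this]

end Updates

/-! ### Configurations, instructions and updates of the two-process program -/

section Simulation

variable {Q M : Type} {L : PCS Q M} {QF : Set Q}

open SimVar SimVal

/-- The memory with the given values of the three variables. -/
def simMem (mx mr my : SimVal M) : SimVar → SimVal M
  | .xw => mx
  | .xr => mr
  | .y => my

@[simp] theorem simMem_xw (mx mr my : SimVal M) : simMem mx mr my xw = mx := rfl
@[simp] theorem simMem_xr (mx mr my : SimVal M) : simMem mx mr my xr = mr := rfl
@[simp] theorem simMem_y (mx mr my : SimVal M) : simMem mx mr my SimVar.y = my := rfl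

/-- The configuration with the given components. -/
def simConf (a : SimState1 L) (b : SimState2 M) (u v : List (SimVar × SimVal M))
    (mx mr my : SimVal M) : TSOConf SimProc SimVar (SimVal M) (SimState L) where
  state
    | .p1 => a
    | .p2 => b
  buffer
    | .p1 => u
    | .p2 => v
  memory := simMem mx mr my

theorem exists_eq_simConf (c : TSOConf SimProc SimVar (SimVal M) (SimState L)) :
    ∃ a b u v mx mr my, c = simConf a b u v mx mr my := by
  obtain ⟨s, b, m⟩ := c
  refine ⟨s .p1, s .p2, b .p1, b .p2, m .xw, m .xr, m .y, ?_⟩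
  unfold simConf
  congr
  · funext i; cases i <;> rfl
  · funext i; cases i <;> rfl
  · funext i; cases i <;> rfl

/-- Instruction `ins` can be executed with memory `mem` and own buffer `b`, which becomes `b'`. -/
def Exec (mem : SimVar → SimVal M) (b : List (SimVar × SimVal M)) :
    Instr SimVar (SimVal M) → List (SimVar × SimVal M) → Prop
  | .read x d, b' => b' = b ∧
      ((∃ w, pendingOn x b = (x, d) :: w) ∨ pendingOn x b = [] ∧ mem x = d)
  | .write x d, b' => b' = (x, d) :: b
  | .arw _ _ _, _ => False
  | .nop, b' => b' = b
  | .fence, b' => b' = b ∧ b = []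

/-- This turns the analysis of a move into a case distinction on `SimTrans1` or `SimTrans2` plus an
executability condition. The program contains no atomic read-write, so `Exec` may declare it
impossible. -/
theorem instrStep_simConf_iff {a : SimState1 L} {b : SimState2 M} {u v : List (SimVar × SimVal M)}
    {mx mr my : SimVal M} {c : TSOConf SimProc SimVar (SimVal M) (SimState L)} :
    InstrStep (simProgram L QF) (simConf a b u v mx mr my) c ↔
      (∃ ins a' u', SimTrans1 L QF a ins a' ∧ Exec (simMem mx mr my) u ins u' ∧
        c = simConf a' b u' v mx mr my) ∨
      ∃ ins b' v', SimTrans2 M b ins b' ∧ Exec (simMem mx mr my) v ins v' ∧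
        c = simConf a b' u v' mx mr my := by
  have st1 : ∀ a' : SimState1 L,
      Function.update (simConf a b u v mx mr my).state .p1 a' =
        (simConf a' b u v mx mr my).state := by
    intro a'; funext i; cases i <;> rfl
  have st2 : ∀ b' : SimState2 M,
      Function.update (simConf a b u v mx mr my).state .p2 b' =
        (simConf a b' u v mx mr my).state := by
    intro a'; funext i; cases i <;> rfl
  have bu1 : ∀ u', Function.update (simConf a b u v mx mr my).buffer .p1 u' =
        (simConf a b u' v mx mr my).buffer := by
    intro a'; funext i; cases i <;> rfl
  have bu2 : ∀ u', Function.update (simConf a b u v mx mr my).buffer .p2 u' =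
        (simConf a b u u' mx mr my).buffer := by
    intro a'; funext i; cases i <;> rfl
  constructor
  · intro h
    cases h with
    | @readOwnWrite i x d s' w ht hp =>
      cases i
      · exact .inl ⟨_, s', u, ht, ⟨rfl, .inl ⟨_, hp⟩⟩, by rw [st1]; rfl⟩
      · exact .inr ⟨_, s', v, ht, ⟨rfl, .inl ⟨_, hp⟩⟩, by rw [st2]; rfl⟩
    | @readFromMemory i x d s' ht hp hm =>
      cases i
      · exact .inl ⟨_, s', u, ht, ⟨rfl, .inr ⟨hp, hm⟩⟩, by rw [st1]; rfl⟩
      · exact .inr ⟨_, s', v, ht, ⟨rfl, .inr ⟨hp, hm⟩⟩, by rw [st2]; rfl⟩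
    | @write i x d s' ht =>
      cases i
      · exact .inl ⟨_, s', _, ht, rfl, by rw [st1, bu1]; rfl⟩
      · exact .inr ⟨_, s', _, ht, rfl, by rw [st2, bu2]; rfl⟩
    | @arw i x d d' s' ht =>
      cases i
      · generalize hins : Instr.arw x d d' = ins at ht
        change SimTrans1 L QF _ ins _ at ht
        cases ht <;> cases hins
      · generalize hins : Instr.arw x d d' = ins at ht
        change SimTrans2 M _ ins _ at ht
        cases ht <;> cases hins
    | @skip i s' ht =>
      cases i
      · exact .inl ⟨_, s', u, ht, rfl, by rw [st1]; rfl⟩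
      · exact .inr ⟨_, s', v, ht, rfl, by rw [st2]; rfl⟩
    | @fence i s' ht hp =>
      cases i
      · exact .inl ⟨_, s', u, ht, ⟨rfl, hp⟩, by rw [st1]; rfl⟩
      · exact .inr ⟨_, s', v, ht, ⟨rfl, hp⟩, by rw [st2]; rfl⟩
  · rintro (⟨ins, a', u', ht, he, rfl⟩ | ⟨ins, b', v', ht, he, rfl⟩)
    · cases ins with
      | read x d =>
        obtain ⟨rfl, ⟨w, hw⟩ | ⟨hp, hm⟩⟩ := he
        · have := InstrStep.readOwnWrite (P := simProgram L QF)
            (c := simConf a b u' v mx mr my) .p1 (s' := a') ht hw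
          rwa [st1] at this
        · have := InstrStep.readFromMemory (P := simProgram L QF)
            (c := simConf a b u' v mx mr my) .p1 (s' := a') ht hp hm
          rwa [st1] at this
      | write x d =>
        obtain rfl := he
        have := InstrStep.write (P := simProgram L QF)
            (c := simConf a b u v mx mr my) .p1 (s' := a') ht
        rw [st1] at this
        erw [bu1] at this
        exact this
      | arw => exact he.elim
      | nop =>
        obtain rfl := he
        have := InstrStep.skip (P := simProgram L QF)
            (c := simConf a b u' v mx mr my) .p1 (s' := a') ht
        rwa [st1] at this
      | fence =>
        obtain ⟨rfl, hb⟩ := he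
        have := InstrStep.fence (P := simProgram L QF)
            (c := simConf a b u' v mx mr my) .p1 (s' := a') ht hb
        rwa [st1] at this
    · cases ins with
      | read x d =>
        obtain ⟨rfl, ⟨w, hw⟩ | ⟨hp, hm⟩⟩ := he
        · have := InstrStep.readOwnWrite (P := simProgram L QF)
            (c := simConf a b u v' mx mr my) .p2 (s' := b') ht hw
          rwa [st2] at this
        · have := InstrStep.readFromMemory (P := simProgram L QF)
            (c := simConf a b u v' mx mr my) .p2 (s' := b') ht hp hm
          rwa [st2] at this
      | write x d =>
        obtain rfl := he
        have := InstrStep.write (P := simProgram L QF)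
            (c := simConf a b u v mx mr my) .p2 (s' := b') ht
        rw [st2] at this
        erw [bu2] at this
        exact this
      | arw => exact he.elim
      | nop =>
        obtain rfl := he
        have := InstrStep.skip (P := simProgram L QF)
            (c := simConf a b u v' mx mr my) .p2 (s' := b') ht
        rwa [st2] at this
      | fence =>
        obtain ⟨rfl, hb⟩ := he
        have := InstrStep.fence (P := simProgram L QF)
            (c := simConf a b u v' mx mr my) .p2 (s' := b') ht hb
        rwa [st2] at this

theorem updates_simConf {a : SimState1 L} {b : SimState2 M} {u v : List (SimVar × SimVal M)}
    {mx mr my : SimVal M} {d : TSOConf SimProc SimVar (SimVal M) (SimState L)}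
    (h : Relation.ReflTransGen UpdateStep (simConf a b u v mx mr my) d) :
    ∃ u' v' pu pv mx' mr' my', d = simConf a b u' v' mx' mr' my' ∧ u = u' ++ pu ∧ v = v' ++ pv ∧
      ∀ z, (pendingOn z pv = [] → simMem mx' mr' my' z = valAfter z pu (simMem mx mr my z)) ∧
        (pendingOn z pu = [] → simMem mx' mr' my' z = valAfter z pv (simMem mx mr my z)) := by
  obtain ⟨a', b', u', v', mx', mr', my', rfl⟩ := exists_eq_simConf d
  obtain ⟨hs, p, hp, hm⟩ := updates_spec h
  obtain rfl : a' = a := congrFun hs .p1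
  obtain rfl : b' = b := congrFun hs .p2
  refine ⟨u', v', p .p1, p .p2, mx', mr', my', rfl, hp .p1, hp .p2, fun z =>
    ⟨fun hz => hm z .p1 ?_, fun hz => hm z .p2 ?_⟩⟩
  · rintro (_ | _) hj
    · exact absurd rfl hj
    · exact hz
  · rintro (_ | _) hj
    · exact hz
    · exact absurd rfl hj

/-- An update of process 1. -/
theorem simConf_update_p1 (a : SimState1 L) (b : SimState2 M) (u v : List (SimVar × SimVal M))
    (mx mr my : SimVal M) (z : SimVar) (d : SimVal M) :
    UpdateStep (simConf a b (u ++ [(z, d)]) v mx mr my)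
      (simConf a b u v (valAfter xw [(z, d)] mx) (valAfter xr [(z, d)] mr)
        (valAfter SimVar.y [(z, d)] my)) := by
  have := UpdateStep.update (c := simConf a b (u ++ [(z, d)]) v mx mr my) .p1 (w := u) rfl
  convert this using 1
  unfold simConf
  congr 1
  · funext i; cases i <;> rfl
  · funext i; cases i <;> cases z <;> rfl

/-- An update of process 2. -/
theorem simConf_update_p2 (a : SimState1 L) (b : SimState2 M) (u v : List (SimVar × SimVal M))
    (mx mr my : SimVal M) (z : SimVar) (d : SimVal M) :
    UpdateStep (simConf a b u (v ++ [(z, d)]) mx mr my)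
      (simConf a b u v (valAfter xw [(z, d)] mx) (valAfter xr [(z, d)] mr)
        (valAfter SimVar.y [(z, d)] my)) := by
  have := UpdateStep.update (c := simConf a b u (v ++ [(z, d)]) mx mr my) .p2 (w := v) rfl
  convert this using 1
  unfold simConf
  congr 1
  · funext i; cases i <;> rfl
  · funext i; cases i <;> cases z <;> rfl

theorem simConf_flush_p1 (a : SimState1 L) (b : SimState2 M) (p : List (SimVar × SimVal M)) :
    ∀ (u v : List (SimVar × SimVal M)) (mx mr my : SimVal M),
    Relation.ReflTransGen UpdateStep (simConf a b (u ++ p) v mx mr my)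
      (simConf a b u v (valAfter xw p mx) (valAfter xr p mr) (valAfter SimVar.y p my)) := by
  induction p with
  | nil => intro u v mx mr my; simpa using Relation.ReflTransGen.refl
  | cons e p ih =>
    intro u v mx mr my
    obtain ⟨z, d⟩ := e
    have := ih (u ++ [(z, d)]) v mx mr my
    rw [List.append_assoc, List.singleton_append] at this
    convert this.tail (simConf_update_p1 ..) using 2 <;> simp [valAfter_cons]

theorem simConf_flush_p2 (a : SimState1 L) (b : SimState2 M) (p : List (SimVar × SimVal M)) :
    ∀ (u v : List (SimVar × SimVal M)) (mx mr my : SimVal M),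
    Relation.ReflTransGen UpdateStep (simConf a b u (v ++ p) mx mr my)
      (simConf a b u v (valAfter xw p mx) (valAfter xr p mr) (valAfter SimVar.y p my)) := by
  induction p with
  | nil => intro u v mx mr my; simpa using Relation.ReflTransGen.refl
  | cons e p ih =>
    intro u v mx mr my
    obtain ⟨z, d⟩ := e
    have := ih u (v ++ [(z, d)]) mx mr my
    rw [List.append_assoc, List.singleton_append] at this
    convert this.tail (simConf_update_p2 ..) using 2 <;> simp [valAfter_cons]

/-! ### Store buffers that represent channel contents -/

/-- The store buffer that represents a channel content. -/
def bufferOf (w : List M) : List (SimVar × SimVal M) :=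
  w.flatMap fun m => [(SimVar.y, one), (xw, msg m)]

/-- Every pending write is a message or a `1` for `y`. -/
def IsSends (u : List (SimVar × SimVal M)) : Prop :=
  ∀ e ∈ u, (∃ m, e = (xw, msg m)) ∨ e = (SimVar.y, one)

theorem isSends_bufferOf (w : List M) : IsSends (bufferOf w) := by
  intro e he
  simp only [bufferOf, List.mem_flatMap, List.mem_cons, List.not_mem_nil, or_false] at he
  obtain ⟨m, _, rfl | rfl⟩ := he
  · exact .inr rfl
  · exact .inl ⟨m, rfl⟩

theorem bufferOf_append (w : List M) (m : M) :
    bufferOf (w ++ [m]) = bufferOf w ++ [(SimVar.y, one), (xw, msg m)] := by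
  simp [bufferOf]

theorem IsSends.pendingOn_xr {u : List (SimVar × SimVal M)} (h : IsSends u) :
    pendingOn xr u = [] := by
  rw [pendingOn, List.filter_eq_nil_iff]
  intro e he
  rcases h e he with ⟨m, rfl⟩ | rfl <;> simp

theorem IsSends.of_append_right {u p : List (SimVar × SimVal M)} (h : IsSends (u ++ p)) :
    IsSends p := fun e he => h e (List.mem_append_right _ he)

theorem IsSends.append {u p : List (SimVar × SimVal M)} (h : IsSends u) (h' : IsSends p) :
    IsSends (u ++ p) := fun e he => (List.mem_append.1 he).elim (h e) (h' e)

/-- The pending writes are sends, the oldest of which (if any) is a message. -/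
def IsQueue (u : List (SimVar × SimVal M)) : Prop :=
  IsSends u ∧ ∀ u' e, u = u' ++ [e] → ∃ m, e = (xw, msg m)

/-- The pending writes are sends, the oldest of which is a `1` for `y`. -/
def IsAcked (u : List (SimVar × SimVal M)) : Prop :=
  IsSends u ∧ ∀ u' e, u = u' ++ [e] → e = (SimVar.y, one)

theorem isQueue_bufferOf (w : List M) : IsQueue (bufferOf w) := by
  refine ⟨isSends_bufferOf w, fun u' e h => ?_⟩
  rcases List.eq_nil_or_concat w with rfl | ⟨w', m, rfl⟩
  · simp [bufferOf] at h
  · rw [List.concat_eq_append, bufferOf_append, ← List.singleton_append, ← List.append_assoc] at h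
    obtain ⟨_, h⟩ := List.append_inj' h rfl
    exact ⟨m, by simpa using h.symm⟩

theorem IsQueue.cons {u : List (SimVar × SimVal M)} (h : IsQueue u) (m : M) :
    IsQueue ((xw, msg m) :: u) := by
  refine ⟨fun e he => ?_, fun u' e he => ?_⟩
  · rcases List.mem_cons.1 he with rfl | he
    · exact .inl ⟨m, rfl⟩
    · exact h.1 e he
  · cases u' with
    | nil => simp at he; exact ⟨m, he.1.symm⟩
    | cons e' u' => simp at he; exact h.2 u' e he.2

theorem isAcked_bufferOf_append (w : List M) : IsAcked (bufferOf w ++ [(SimVar.y, one)]) := by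
  refine ⟨(isSends_bufferOf w).append (by simp [IsSends]), fun u' e h => ?_⟩
  obtain ⟨_, h⟩ := List.append_inj' h rfl
  simpa using h.symm

theorem IsSends.valAfter_xw {p : List (SimVar × SimVal M)} (h : IsSends p) {m : M}
    (hm : (xw, msg m) ∈ p) (d : SimVal M) : ∃ m', valAfter xw p d = msg m' := by
  induction p with
  | nil => simp at hm
  | cons e p ih =>
    rcases h e (by simp) with ⟨m', rfl⟩ | rfl
    · exact ⟨m', by simp [valAfter_cons]⟩
    · rw [valAfter_cons, if_neg (by simp)]
      exact ih (fun e he => h e (by simp [he])) (by simpa using hm)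

theorem IsSends.valAfter_y {p : List (SimVar × SimVal M)} (h : IsSends p)
    (hm : (SimVar.y, one) ∈ p) (d : SimVal M) : valAfter SimVar.y p d = one := by
  induction p with
  | nil => simp at hm
  | cons e p ih =>
    rcases h e (by simp) with ⟨m', rfl⟩ | rfl
    · rw [valAfter_cons, if_neg (by simp)]
      exact ih (fun e he => h e (by simp [he])) (by simpa using hm)
    · simp [valAfter_cons]

/-- A nonempty flushed part contains the oldest pending write, which is a message, and only another
message can overwrite it in `xw`. So no update of a queue goes unnoticed; `IsAcked.valAfter_y` is
the analogue for `y`. -/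
theorem IsQueue.valAfter_xw {u p : List (SimVar × SimVal M)} (h : IsQueue (u ++ p)) (hp : p ≠ [])
    (d : SimVal M) : ∃ m, valAfter xw p d = msg m := by
  obtain ⟨m, hm⟩ := h.2 (u ++ p.dropLast) (p.getLast hp) (by simp [List.dropLast_append_getLast])
  exact h.1.of_append_right.valAfter_xw (hm ▸ List.getLast_mem hp) d

theorem IsAcked.valAfter_y {u p : List (SimVar × SimVal M)} (h : IsAcked (u ++ p)) (hp : p ≠ [])
    (d : SimVal M) : valAfter SimVar.y p d = one := by
  have hm := h.2 (u ++ p.dropLast) (p.getLast hp) (by simp [List.dropLast_append_getLast])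
  exact h.1.of_append_right.valAfter_y (hm ▸ List.getLast_mem hp) d

/-- Updates either leave a queue alone or bring a message to the memory. -/
theorem updates_of_isQueue {a : SimState1 L} {b : SimState2 M} {u v : List (SimVar × SimVal M)}
    {mx mr my : SimVal M} {d : TSOConf SimProc SimVar (SimVal M) (SimState L)}
    (h : Relation.ReflTransGen UpdateStep (simConf a b u v mx mr my) d) (hu : IsQueue u)
    (hv : pendingOn xw v = []) :
    (∃ v' pv, v = v' ++ pv ∧ d = simConf a b u v' mx (valAfter xr pv mr) (valAfter SimVar.y pv my)) ∨
    ∃ u' v' m mr' my', pendingOn xw v' = [] ∧ d = simConf a b u' v' (msg m) mr' my' := by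
  obtain ⟨u', v', pu, pv, mx', mr', my', rfl, rfl, rfl, hm⟩ := updates_simConf h
  rw [pendingOn_append, List.append_eq_nil_iff] at hv
  by_cases hpu : pu = []
  · subst hpu
    refine .inl ⟨v', pv, rfl, ?_⟩
    have h1 := (hm xw).1 hv.2
    have h2 := (hm xr).2 rfl
    have h3 := (hm SimVar.y).2 rfl
    simp only [simMem_xw, simMem_xr, simMem_y, valAfter_nil] at h1 h2 h3
    rw [h1, h2, h3, List.append_nil]
  · obtain ⟨m, hm'⟩ := hu.valAfter_xw hpu mx
    have h1 := (hm xw).1 hv.2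
    simp only [simMem_xw, hm'] at h1
    exact .inr ⟨u', v', m, mr', my', hv.1, by rw [h1]⟩

/-- Updates either leave an acknowledged buffer alone or bring a `1` to the memory. -/
theorem updates_of_isAcked {a : SimState1 L} {b : SimState2 M} {u v : List (SimVar × SimVal M)}
    {mx mr my : SimVal M} {d : TSOConf SimProc SimVar (SimVal M) (SimState L)}
    (h : Relation.ReflTransGen UpdateStep (simConf a b u v mx mr my) d) (hu : IsAcked u)
    (hv : pendingOn SimVar.y v = []) :
    (∃ v' pv, v = v' ++ pv ∧ d = simConf a b u v' (valAfter xw pv mx) (valAfter xr pv mr) my) ∨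
    ∃ u' v' mx' mr', pendingOn SimVar.y v' = [] ∧ d = simConf a b u' v' mx' mr' one := by
  obtain ⟨u', v', pu, pv, mx', mr', my', rfl, rfl, rfl, hm⟩ := updates_simConf h
  rw [pendingOn_append, List.append_eq_nil_iff] at hv
  by_cases hpu : pu = []
  · subst hpu
    refine .inl ⟨v', pv, rfl, ?_⟩
    have h1 := (hm xw).2 rfl
    have h2 := (hm xr).2 rfl
    have h3 := (hm SimVar.y).1 hv.2
    simp only [simMem_xw, simMem_xr, simMem_y, valAfter_nil] at h1 h2 h3
    rw [h1, h2, h3, List.append_nil]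
  · have h1 := (hm SimVar.y).1 hv.2
    simp only [simMem_y, hu.valAfter_y hpu] at h1
    exact .inr ⟨u', v', mx', mr', hv.1, by rw [h1]⟩

end Simulation

/-! ### Absence of deadlocks and the winning moves of player B -/

section Simulation

variable {Q M : Type} {L : PCS Q M} {QF : Set Q}

open SimVar SimVal

variable (L QF) in
/-- The game of the simulating program. -/
abbrev simGame : SafetyGame := abtsoGame (simProgram L QF) (simFinal L)

/-- Every state of process 2 has an outgoing nop or write, and these are never blocked. -/
theorem simGame_deadlockFree : (simGame L QF).DeadlockFree := by
  rintro ⟨p, c⟩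
  obtain ⟨a, b, u, v, mx, mr, my, rfl⟩ := exists_eq_simConf c
  suffices h : ∃ ins b' v', SimTrans2 M b ins b' ∧ Exec (simMem mx mr my) v ins v' by
    obtain ⟨ins, b', v', h1, h2⟩ := h
    exact ⟨(p.other, simConf a b' u v' mx mr my), rfl, _,
      instrStep_simConf_iff.2 (.inr ⟨ins, b', v', h1, h2, rfl⟩), .refl⟩
  cases b with
  | s1 => exact ⟨_, _, _, .main1, rfl⟩
  | s2 => exact ⟨_, _, _, .final2, rfl⟩
  | sm m => exact ⟨_, _, _, .lose3 m, rfl⟩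
  | s4 => exact ⟨_, _, _, .final4, rfl⟩
  | s5 => exact ⟨_, _, _, .main5, rfl⟩
  | s6 => exact ⟨_, _, _, .lose6, rfl⟩
  | s7 => exact ⟨_, _, _, .main7, rfl⟩
  | s8 => exact ⟨_, _, _, .main8, rfl⟩
  | s9 => exact ⟨_, _, _, .main9, rfl⟩
  | s10 => exact ⟨_, _, _, .lose10, rfl⟩
  | s11 => exact ⟨_, _, _, .main11, rfl⟩
  | s12 => exact ⟨_, _, _, .main12, rfl⟩
  | sF => exact ⟨_, _, _, .loop_sF, rfl⟩
  | sL => exact ⟨_, _, _, .loop_sL, rfl⟩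

variable {a : SimState1 L} {b : SimState2 M} {u v : List (SimVar × SimVal M)} {mx mr my : SimVal M}

/-! ### Player B simulates the channel system -/

theorem attr_A {c : TSOConf SimProc SimVar (SimVal M) (SimState L)}
    (h : ∀ c', InstrStep (simProgram L QF) c c' → ∀ d, Relation.ReflTransGen UpdateStep c' d →
      (simGame L QF).Attr (.B, d)) : (simGame L QF).Attr (.A, c) := by
  refine .all_moves rfl ?_
  rintro ⟨p, d⟩ ⟨rfl : p = _, c', h1, h2⟩
  exact h c' h1 d h2

theorem attr_sF (p : Player) : (simGame L QF).Attr (p, simConf a .sF u v mx mr my) := by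
  have hA : ∀ (a : SimState1 L) (u v : List (SimVar × SimVal M)) (mx mr my : SimVal M),
      (simGame L QF).Attr (.A, simConf a .sF u v mx mr my) :=
    fun _ _ _ _ _ _ => .final ⟨rfl, .p2, rfl⟩
  cases p with
  | A => exact hA ..
  | B =>
    exact .some_move rfl ⟨rfl, _, instrStep_simConf_iff.2 (.inr ⟨_, _, _, .loop_sF, rfl, rfl⟩), .refl⟩
      (hA a u v mx mr my)

/-- A move of process 1 by player B. -/
theorem attr_B1 {a' : SimState1 L} {ins : Instr SimVar (SimVal M)}
    {u' : List (SimVar × SimVal M)} {d : TSOConf SimProc SimVar (SimVal M) (SimState L)}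
    (h1 : SimTrans1 L QF a ins a') (h2 : Exec (simMem mx mr my) u ins u')
    (h3 : Relation.ReflTransGen UpdateStep (simConf a' b u' v mx mr my) d)
    (h : (simGame L QF).Attr (.A, d)) : (simGame L QF).Attr (.B, simConf a b u v mx mr my) :=
  .some_move rfl ⟨rfl, _, instrStep_simConf_iff.2 (.inl ⟨_, _, _, h1, h2, rfl⟩), h3⟩ h

/-- A move of process 2 by player B. -/
theorem attr_B2 {b' : SimState2 M} {ins : Instr SimVar (SimVal M)}
    {v' : List (SimVar × SimVal M)} {d : TSOConf SimProc SimVar (SimVal M) (SimState L)}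
    (h1 : SimTrans2 M b ins b') (h2 : Exec (simMem mx mr my) v ins v')
    (h3 : Relation.ReflTransGen UpdateStep (simConf a b' u v' mx mr my) d)
    (h : (simGame L QF).Attr (.A, d)) : (simGame L QF).Attr (.B, simConf a b u v mx mr my) :=
  .some_move rfl ⟨rfl, _, instrStep_simConf_iff.2 (.inr ⟨_, _, _, h1, h2, rfl⟩), h3⟩ h

/-- This and `attr_s4` force player A to move process 2 on from `s2` and `s4`: if it is still there
at the next turn of B, B takes it to `sF`. -/
theorem attr_s2 : (simGame L QF).Attr (.B, simConf a .s2 u v mx mr my) :=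
  attr_B2 .final2 rfl .refl (attr_sF _)

theorem attr_s4 : (simGame L QF).Attr (.B, simConf a .s4 u v mx mr my) :=
  attr_B2 .final4 rfl .refl (attr_sF _)

/-- In these states of the cycle `y` should still be `0`; a `1` shows that player A has updated
process 1 too early. -/
theorem attr_of_y {m : M} (hb : b = .sm m ∨ b = .s5 ∨ b = .s6) (hv : pendingOn SimVar.y v = []) :
    (simGame L QF).Attr (.B, simConf a b u v mx mr one) := by
  rcases hb with rfl | rfl | rfl
  · exact attr_B2 (.final3 m) ⟨rfl, .inr ⟨hv, rfl⟩⟩ .refl (attr_sF _)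
  · exact attr_B2 .final5 ⟨rfl, .inr ⟨hv, rfl⟩⟩ .refl (attr_sF _)
  · exact attr_B2 .final6 ⟨rfl, .inr ⟨hv, rfl⟩⟩ .refl (attr_sF _)

/-- In these states no message should be in `xw`; one that is there shows that player A has updated
process 1 too far. -/
theorem attr_of_xw {m : M} (hb : b = .s1 ∨ b = .s8 ∨ b = .s10 ∨ b = .s12)
    (hv : pendingOn xw v = []) : (simGame L QF).Attr (.B, simConf a b u v (msg m) mr my) := by
  rcases hb with rfl | rfl | rfl | rfl
  · exact attr_B2 (.final1 m) ⟨rfl, .inr ⟨hv, rfl⟩⟩ .refl (attr_sF _)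
  · exact attr_B2 (.final8' m) ⟨rfl, .inr ⟨hv, rfl⟩⟩ .refl (attr_sF _)
  · exact attr_B2 (.final10 m) ⟨rfl, .inr ⟨hv, rfl⟩⟩ .refl (attr_sF _)
  · exact attr_B2 (.final12 m) ⟨rfl, .inr ⟨hv, rfl⟩⟩ .refl (attr_sF _)

theorem attr_of_updates_s2 {d : TSOConf SimProc SimVar (SimVal M) (SimState L)}
    (h : Relation.ReflTransGen UpdateStep (simConf a .s2 u v mx mr my) d) :
    (simGame L QF).Attr (.B, d) := by
  obtain ⟨_, _, _, _, _, _, _, rfl, -⟩ := updates_simConf h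
  exact attr_s2

theorem attr_of_updates_s4 {d : TSOConf SimProc SimVar (SimVal M) (SimState L)}
    (h : Relation.ReflTransGen UpdateStep (simConf a .s4 u v mx mr my) d) :
    (simGame L QF).Attr (.B, d) := by
  obtain ⟨_, _, _, _, _, _, _, rfl, -⟩ := updates_simConf h
  exact attr_s4

theorem attr_of_updates_sF {d : TSOConf SimProc SimVar (SimVal M) (SimState L)}
    (h : Relation.ReflTransGen UpdateStep (simConf a .sF u v mx mr my) d) :
    (simGame L QF).Attr (.B, d) := by
  obtain ⟨_, _, _, _, _, _, _, rfl, -⟩ := updates_simConf h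
  exact attr_sF _

/-- Player A has to let process 1 finish the simulation of a transition. -/
theorem attr_A_s1 (h : ∀ ins a' u', SimTrans1 L QF a ins a' → Exec (simMem bot bot zero) u ins u' →
      IsQueue u' ∧ (simGame L QF).Attr (.B, simConf a' .s1 u' [] bot bot zero)) :
    (simGame L QF).Attr (.A, simConf a .s1 u [] bot bot zero) := by
  refine attr_A fun c' hc d hd => ?_
  rcases instrStep_simConf_iff.1 hc with ⟨ins, a', u', ht, he, rfl⟩ | ⟨ins, b', v', ht, he, rfl⟩
  · obtain ⟨hu, hK⟩ := h ins a' u' ht he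
    rcases updates_of_isQueue hd hu rfl with ⟨v', pv, hv, rfl⟩ | ⟨u'', v', m, mr', my', hv, rfl⟩
    · obtain ⟨rfl, rfl⟩ := List.append_eq_nil_iff.1 hv.symm
      exact hK
    · exact attr_of_xw (.inl rfl) hv
  · cases ht with
    | main1 => exact attr_of_updates_s2 hd
    | final1 => exact attr_of_updates_sF hd
    | final1' => exact attr_of_updates_sF hd
    | lose1 => simp [Exec] at he

/-- After the first half, player A cannot escape to `hL`: the memory holds `⊥` for `xr` and process
1 has no pending write on `xr`. By `attr_A_s1` she has to complete the transition. The same applies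
to `attr_send`. -/
theorem attr_nop {q q' : Q} {w : List M} (h : (q, .nop, q') ∈ L.trans)
    (hK : (simGame L QF).Attr (.B, simConf (.chan q') .s1 (bufferOf w) [] bot bot zero)) :
    (simGame L QF).Attr (.B, simConf (.chan q) .s1 (bufferOf w) [] bot bot zero) := by
  refine attr_B1 (.nop_fst h) rfl .refl (attr_A_s1 fun ins a' u' ht he => ?_)
  cases ht with
  | nop_snd => obtain rfl := he; exact ⟨isQueue_bufferOf w, hK⟩
  | nop_lose => simp [Exec, (isSends_bufferOf w).pendingOn_xr] at he

theorem attr_send {q q' : Q} {m : M} {w : List M} (h : (q, .send m, q') ∈ L.trans)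
    (hK : (simGame L QF).Attr (.B, simConf (.chan q') .s1 (bufferOf (m :: w)) [] bot bot zero)) :
    (simGame L QF).Attr (.B, simConf (.chan q) .s1 (bufferOf w) [] bot bot zero) := by
  refine attr_B1 (.send_fst h) rfl .refl (attr_A_s1 fun ins a' u' ht he => ?_)
  cases ht with
  | send_snd => obtain rfl := he; exact ⟨isQueue_bufferOf (m :: w), hK⟩
  | send_lose => simp [Exec, pendingOn_cons, (isSends_bufferOf w).pendingOn_xr] at he

/-- Player A has to leave the first half of the process 1 part of a receive transition alone. -/
theorem exec_recv_snd {q q' : Q} {m : M} {h : (q, .recv m, q') ∈ L.trans} {a' : SimState1 L}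
    {ins : Instr SimVar (SimVal M)} {u' : List (SimVar × SimVal M)}
    (ht : SimTrans1 L QF (.aux ⟨_, h⟩) ins a') (hu : IsSends u)
    (he : Exec (simMem mx mr my) u ins u') : mr = bot ∧ a' = .chan q' ∧ u' = u := by
  cases ht with
  | recv_snd => simpa [Exec, hu.pendingOn_xr, and_comm] using he

/-- The lemmas from here to `attr_recv` follow the receive cycle backwards. In each of them player A
is to move, and every move other than the intended one is disabled or loses. From `s5` to `s11`,
process 1 waits for `⊥` in `xr`, which still holds the message, so only process 2 can move. -/
theorem attr_recv_s11 {q q' : Q} {m : M} {w : List M} (h : (q, .recv m, q') ∈ L.trans)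
    (hK : (simGame L QF).Attr (.B, simConf (.chan q') .s1 (bufferOf w) [] bot bot zero)) :
    (simGame L QF).Attr (.A, simConf (.aux ⟨_, h⟩) .s11 (bufferOf w) [] bot (msg m) zero) := by
  refine attr_A fun c' hc d hd => ?_
  rcases instrStep_simConf_iff.1 hc with ⟨ins, a', u', ht, he, rfl⟩ | ⟨ins, b', v', ht, he, rfl⟩
  · simpa using (exec_recv_snd ht (isSends_bufferOf w) he).1
  · cases ht with
    | main11 =>
      obtain rfl := he
      rcases updates_of_isQueue hd (isQueue_bufferOf w) rfl with
        ⟨v', pv, hv, rfl⟩ | ⟨u'', v', m, mr', my', hv, rfl⟩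
      · have hK' : (simGame L QF).Attr (.A,
            simConf (.aux ⟨_, h⟩) .s1 (bufferOf w) [] bot bot zero) := by
          refine attr_A_s1 fun ins a' u' ht he => ?_
          obtain ⟨-, rfl, rfl⟩ := exec_recv_snd ht (isSends_bufferOf w) he
          exact ⟨isQueue_bufferOf w, hK⟩
        -- Either player A has left the write of `⊥` to `xr` pending, or she has updated it already;
        -- in the first case B flushes it after the next instruction.
        rcases List.append_eq_singleton_iff.1 hv.symm with ⟨rfl, rfl⟩ | ⟨rfl, rfl⟩
        · exact attr_B2 .main12 rfl .refl hK'
        · exact attr_B2 .main12 rfl (simConf_flush_p2 _ _ [(xr, bot)] _ [] _ _ _) hK'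
      · exact attr_of_xw (.inr (.inr (.inr rfl))) hv
    | lose11 => simp [Exec] at he

theorem attr_recv_s9 {q q' : Q} {m : M} {w : List M} (h : (q, .recv m, q') ∈ L.trans)
    (hK : (simGame L QF).Attr (.B, simConf (.chan q') .s1 (bufferOf w) [] bot bot zero)) :
    (simGame L QF).Attr (.A, simConf (.aux ⟨_, h⟩) .s9 (bufferOf w) [] bot (msg m) zero) := by
  refine attr_A fun c' hc d hd => ?_
  rcases instrStep_simConf_iff.1 hc with ⟨ins, a', u', ht, he, rfl⟩ | ⟨ins, b', v', ht, he, rfl⟩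
  · simpa using (exec_recv_snd ht (isSends_bufferOf w) he).1
  · cases ht with
    | main9 =>
      obtain rfl := he
      rcases updates_of_isQueue hd (isQueue_bufferOf w) rfl with
        ⟨v', pv, hv, rfl⟩ | ⟨u'', v', m, mr', my', hv, rfl⟩
      · obtain ⟨rfl, rfl⟩ := List.append_eq_nil_iff.1 hv.symm
        exact attr_B2 .main10 ⟨rfl, rfl⟩ .refl (attr_recv_s11 h hK)
      · exact attr_of_xw (.inr (.inr (.inl rfl))) hv
    | lose9 => simp [Exec] at he

/-- This is where player A has to update exactly one write, the `1` left behind by the received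
message. With no update, B reads `0` from `y` in `s8`; with more than one, a further message has
reached `xw` and B reads it. -/
theorem attr_recv_s7 {q q' : Q} {m : M} {w : List M} (h : (q, .recv m, q') ∈ L.trans)
    (hK : (simGame L QF).Attr (.B, simConf (.chan q') .s1 (bufferOf w) [] bot bot zero)) :
    (simGame L QF).Attr (.A,
      simConf (.aux ⟨_, h⟩) .s7 (bufferOf w ++ [(SimVar.y, one)]) [] bot (msg m) zero) := by
  have hs := isAcked_bufferOf_append w
  refine attr_A fun c' hc d hd => ?_
  rcases instrStep_simConf_iff.1 hc with ⟨ins, a', u', ht, he, rfl⟩ | ⟨ins, b', v', ht, he, rfl⟩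
  · simpa using (exec_recv_snd ht hs.1 he).1
  · cases ht with
    | main7 =>
      obtain rfl := he
      obtain ⟨u', v', pu, pv, mx', mr', my', rfl, hu, hv, hm⟩ := updates_simConf hd
      obtain ⟨rfl, rfl⟩ := List.append_eq_nil_iff.1 hv.symm
      have hmx := (hm xw).1 rfl
      have hmr := (hm xr).1 rfl
      have hmy := (hm SimVar.y).1 rfl
      simp only [simMem_xw, simMem_xr, simMem_y] at hmx hmr hmy
      rcases List.eq_nil_or_concat pu with rfl | ⟨pu, e, rfl⟩
      · obtain rfl : my' = zero := hmy
        exact attr_B2 .final8 ⟨rfl, .inr ⟨rfl, rfl⟩⟩ .refl (attr_sF _)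
      -- The oldest flushed write `e` is the `1` for `y`; the rest `pu` of the flushed part is the
      -- tail of a queue.
      · rw [List.concat_eq_append, ← List.append_assoc] at hu
        obtain ⟨hw, he⟩ := List.append_inj' hu rfl
        obtain rfl : (SimVar.y, one) = e := by simpa using he
        have hq := isQueue_bufferOf w
        rw [List.concat_eq_append] at hmx hmr hmy
        by_cases hpu : pu = []
        · subst hpu
          rw [List.append_nil] at hw
          subst hw
          simp only [List.nil_append, valAfter_cons] at hmx hmr hmy
          simp only [valAfter_nil, reduceCtorEq, if_false, if_true] at hmx hmr hmy
          subst hmx hmr hmy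
          refine attr_B2 .main8 rfl (simConf_flush_p2 _ _ [(SimVar.y, zero)] _ [] _ _ _)
            (attr_recv_s9 h hK)
        · rw [hw] at hq
          obtain ⟨m', hm'⟩ := hq.valAfter_xw hpu bot
          have : mx' = msg m' := by
            rw [hmx, ← hm']
            simp [valAfter, pendingOn]
          subst this
          exact attr_of_xw (.inr (.inl rfl)) rfl
    | lose7 => simp [Exec] at he

theorem attr_recv_s5 {q q' : Q} {m : M} {w : List M} (h : (q, .recv m, q') ∈ L.trans)
    (hK : (simGame L QF).Attr (.B, simConf (.chan q') .s1 (bufferOf w) [] bot bot zero)) :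
    (simGame L QF).Attr (.A,
      simConf (.aux ⟨_, h⟩) .s5 (bufferOf w ++ [(SimVar.y, one)]) [] bot (msg m) zero) := by
  have hs := isAcked_bufferOf_append w
  refine attr_A fun c' hc d hd => ?_
  rcases instrStep_simConf_iff.1 hc with ⟨ins, a', u', ht, he, rfl⟩ | ⟨ins, b', v', ht, he, rfl⟩
  · simpa using (exec_recv_snd ht hs.1 he).1
  · cases ht with
    | main5 =>
      obtain rfl := he
      rcases updates_of_isAcked hd hs rfl with ⟨v', pv, hv, rfl⟩ | ⟨u'', v', mx', mr', hv, rfl⟩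
      · obtain ⟨rfl, rfl⟩ := List.append_eq_nil_iff.1 hv.symm
        exact attr_B2 .main6 ⟨rfl, rfl⟩ .refl (attr_recv_s7 h hK)
      · exact attr_of_y (m := m) (.inr (.inr rfl)) hv
    | final5 => exact attr_of_updates_sF hd
    | lose5 => simp [Exec] at he

/-- Player A has to start the reset of `xw`. Player B answers with the read of `xr` in process 1, so
that process 1 is blocked from then on, and sees to it that `⊥` has reached `xw`. -/
theorem attr_recv_s4 {q q' : Q} {m : M} {w : List M} (h : (q, .recv m, q') ∈ L.trans)
    (hK : (simGame L QF).Attr (.B, simConf (.chan q') .s1 (bufferOf w) [] bot bot zero)) :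
    (simGame L QF).Attr (.A,
      simConf (.chan q) .s4 (bufferOf w ++ [(SimVar.y, one)]) [] (msg m) (msg m) zero) := by
  have hs := isAcked_bufferOf_append w
  refine attr_A fun c' hc d hd => ?_
  rcases instrStep_simConf_iff.1 hc with ⟨ins, a', u', ht, he, rfl⟩ | ⟨ins, b', v', ht, he, rfl⟩
  · exact attr_of_updates_s4 hd
  · cases ht with
    | main4 =>
      obtain rfl := he
      have hx : Exec (simMem bot (msg m) zero) (bufferOf w ++ [(SimVar.y, one)])
          (.read xr (msg m)) (bufferOf w ++ [(SimVar.y, one)]) :=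
        ⟨rfl, .inr ⟨hs.1.pendingOn_xr, rfl⟩⟩
      rcases updates_of_isAcked hd hs rfl with ⟨v', pv, hv, rfl⟩ | ⟨u'', v', mx', mr', hv, rfl⟩
      · rcases List.append_eq_singleton_iff.1 hv.symm with ⟨rfl, rfl⟩ | ⟨rfl, rfl⟩
        · exact attr_B1 (.recv_fst h) hx .refl (attr_recv_s5 h hK)
        · exact attr_B1 (.recv_fst h) hx (simConf_flush_p2 _ _ [(xw, bot)] _ [] _ _ _)
            (attr_recv_s5 h hK)
      · exact attr_of_y (m := m) (.inr (.inl rfl)) hv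
    | final4 => exact attr_of_updates_sF hd
    | lose4 => simp [Exec] at he

/-- Player B opens the cycle by moving process 2 to `s2` and updating just the oldest message. The
threat of `attr_s2` makes A take the read of this message, and B then copies it to `xr`. -/
theorem attr_recv {q q' : Q} {m : M} {w : List M} (h : (q, .recv m, q') ∈ L.trans)
    (hK : (simGame L QF).Attr (.B, simConf (.chan q') .s1 (bufferOf w) [] bot bot zero)) :
    (simGame L QF).Attr (.B, simConf (.chan q) .s1 (bufferOf (w ++ [m])) [] bot bot zero) := by
  have hs := isAcked_bufferOf_append w
  have hu : bufferOf (w ++ [m]) = (bufferOf w ++ [(SimVar.y, one)]) ++ [(xw, msg m)] := by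
    simp [bufferOf_append]
  rw [hu]
  refine attr_B2 .main1 rfl (simConf_flush_p1 _ _ [(xw, msg m)] _ [] _ _ _)
    (attr_A fun c' hc d hd => ?_)
  simp only [valAfter_cons, valAfter_nil, reduceCtorEq, if_false, if_true] at hc
  rcases instrStep_simConf_iff.1 hc with ⟨ins, a', u', ht, he, rfl⟩ | ⟨ins, b', v', ht, he, rfl⟩
  · exact attr_of_updates_s2 hd
  · cases ht with
    | main2 m' =>
      obtain ⟨rfl, hm⟩ := he
      obtain rfl : m = m' := by simpa using hm
      rcases updates_of_isAcked hd hs rfl with ⟨v', pv, hv, rfl⟩ | ⟨u'', v', mx', mr', hv, rfl⟩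
      · obtain ⟨rfl, rfl⟩ := List.append_eq_nil_iff.1 hv.symm
        exact attr_B2 (.main3 m) rfl (simConf_flush_p2 _ _ [(xr, msg m)] _ [] _ _ _)
          (attr_recv_s4 h hK)
      · exact attr_of_y (.inl rfl) hv
    | final2 => exact attr_of_updates_sF hd
    | lose2 => simp [Exec] at he
    | lose2' => simp [Exec] at he

/-- Player B flushes the entire buffer, with `⊤` as its newest write. Then `xw` holds `⊤`, so A
cannot read a message to reach `sL`, and no pending write of process 1 is left that could overwrite
`⊤`. -/
theorem attr_finish {q : Q} {w : List M} (h : q ∈ QF) :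
    (simGame L QF).Attr (.B, simConf (.chan q) .s1 (bufferOf w) [] bot bot zero) := by
  refine attr_B1 (.finish h) rfl
    (simConf_flush_p1 _ _ ((xw, top) :: bufferOf w) [] [] _ _ _) (attr_A fun c' hc d hd => ?_)
  rw [valAfter_cons, if_pos rfl] at hc
  rcases instrStep_simConf_iff.1 hc with ⟨ins, a', u', ht, he, rfl⟩ | ⟨ins, b', v', ht, he, rfl⟩
  · cases ht with
    | loop_hF =>
      obtain rfl := he
      obtain ⟨u', v', pu, pv, mx', mr', my', rfl, hu, hv, hm⟩ := updates_simConf hd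
      obtain ⟨rfl, rfl⟩ := List.append_eq_nil_iff.1 hv.symm
      obtain ⟨rfl, rfl⟩ := List.append_eq_nil_iff.1 hu.symm
      obtain rfl : mx' = top := (hm xw).1 rfl
      exact attr_B2 .final1' ⟨rfl, .inr ⟨rfl, rfl⟩⟩ .refl (attr_sF _)
  · cases ht with
    | main1 => exact attr_of_updates_s2 hd
    | final1 => exact attr_of_updates_sF hd
    | final1' => exact attr_of_updates_sF hd
    | lose1 => simp [Exec] at he

/-- Some state of `QF` is reachable from the given configuration. -/
def PCS.ReachesFrom (L : PCS Q M) (QF : Set Q) (c : Q × List M) : Prop :=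
  ∃ q ∈ QF, ∃ w, Relation.ReflTransGen L.Step c (q, w)

theorem attr_of_reachesFrom {q : Q} {w : List M} (h : L.ReachesFrom QF (q, w)) :
    (simGame L QF).Attr (.B, simConf (.chan q) .s1 (bufferOf w) [] bot bot zero) := by
  obtain ⟨q', hq', w', h⟩ := h
  generalize hc : (q, w) = c at h
  induction h using Relation.ReflTransGen.head_induction_on generalizing q w with
  | refl => cases hc; exact attr_finish hq'
  | head hstep _ ih =>
    cases hstep <;> cases hc
    · exact attr_send ‹_› (ih rfl)
    · exact attr_recv ‹_› (ih rfl)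
    · exact attr_nop ‹_› (ih rfl)

end Simulation

section Simulation

variable {Q M : Type} {L : PCS Q M} {QF : Set Q}

open SimVar SimVal

/-! ### Player A punishes deviations from the simulation -/

variable (L QF) in
/-- The configurations of player B that player A can keep visiting when `QF` is unreachable. -/
inductive SafeB : TSOConf SimProc SimVar (SimVal M) (SimState L) → Prop
  | sL {a u v mx mr my} : SafeB (simConf a .sL u v mx mr my)
  | hL {u mx mr} : IsAcked u → SafeB (simConf .hL .s5 u [] mx mr zero)
  | s1 {q w} : ¬ L.ReachesFrom QF (q, w) →
      SafeB (simConf (.chan q) .s1 (bufferOf w) [] bot bot zero)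
  | sm {q w m} : ¬ L.ReachesFrom QF (q, w ++ [m]) →
      SafeB (simConf (.chan q) (.sm m) (bufferOf w ++ [(SimVar.y, one)]) [] (msg m) bot zero)
  | s5 {q w m} : ¬ L.ReachesFrom QF (q, w ++ [m]) →
      SafeB (simConf (.chan q) .s5 (bufferOf w ++ [(SimVar.y, one)]) [] bot (msg m) zero)
  | s6 {q m q' w} (h : (q, .recv m, q') ∈ L.trans) : ¬ L.ReachesFrom QF (q', w) →
      SafeB (simConf (.aux ⟨_, h⟩) .s6 (bufferOf w ++ [(SimVar.y, one)]) [] bot (msg m) zero)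
  | s8 {q m q' w} (h : (q, .recv m, q') ∈ L.trans) : ¬ L.ReachesFrom QF (q', w) →
      SafeB (simConf (.aux ⟨_, h⟩) .s8 (bufferOf w) [] bot (msg m) one)
  | s10 {q m q' w} (h : (q, .recv m, q') ∈ L.trans) : ¬ L.ReachesFrom QF (q', w) →
      SafeB (simConf (.aux ⟨_, h⟩) .s10 (bufferOf w) [] bot (msg m) zero)
  | s12 {q m q' w} (h : (q, .recv m, q') ∈ L.trans) : ¬ L.ReachesFrom QF (q', w) →
      SafeB (simConf (.aux ⟨_, h⟩) .s12 (bufferOf w) [] bot bot zero)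

variable (L QF) in
/-- The configurations of player A in which she can move to a safe configuration of player B. -/
def SafeA (c : TSOConf SimProc SimVar (SimVal M) (SimState L)) : Prop :=
  ∃ c', InstrStep (simProgram L QF) c c' ∧ ∃ d, Relation.ReflTransGen UpdateStep c' d ∧
    SafeB L QF d

variable {a : SimState1 L} {b : SimState2 M} {u v : List (SimVar × SimVal M)} {mx mr my : SimVal M}

theorem safeA_1 {a' : SimState1 L} {ins : Instr SimVar (SimVal M)}
    {u' : List (SimVar × SimVal M)} {d : TSOConf SimProc SimVar (SimVal M) (SimState L)}
    (h1 : SimTrans1 L QF a ins a') (h2 : Exec (simMem mx mr my) u ins u')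
    (h3 : Relation.ReflTransGen UpdateStep (simConf a' b u' v mx mr my) d)
    (h : SafeB L QF d) : SafeA L QF (simConf a b u v mx mr my) :=
  ⟨_, instrStep_simConf_iff.2 (.inl ⟨_, _, _, h1, h2, rfl⟩), d, h3, h⟩

theorem safeA_2 {b' : SimState2 M} {ins : Instr SimVar (SimVal M)}
    {v' : List (SimVar × SimVal M)} {d : TSOConf SimProc SimVar (SimVal M) (SimState L)}
    (h1 : SimTrans2 M b ins b') (h2 : Exec (simMem mx mr my) v ins v')
    (h3 : Relation.ReflTransGen UpdateStep (simConf a b' u v' mx mr my) d)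
    (h : SafeB L QF d) : SafeA L QF (simConf a b u v mx mr my) :=
  ⟨_, instrStep_simConf_iff.2 (.inr ⟨_, _, _, h1, h2, rfl⟩), d, h3, h⟩

theorem safeA_sL : SafeA L QF (simConf a .sL u v mx mr my) := safeA_2 .loop_sL rfl .refl .sL

/-- These punishments mirror those of player B: when B has updated process 1 too far, process 2 can
read the evidence and enter `sL`, which it never leaves. -/
theorem safeA_of_y (hb : b = .s2 ∨ b = .s4 ∨ b = .s5 ∨ b = .s7) (hv : pendingOn SimVar.y v = []) :
    SafeA L QF (simConf a b u v mx mr one) := by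
  rcases hb with rfl | rfl | rfl | rfl
  · exact safeA_2 .lose2' ⟨rfl, .inr ⟨hv, rfl⟩⟩ .refl .sL
  · exact safeA_2 .lose4 ⟨rfl, .inr ⟨hv, rfl⟩⟩ .refl .sL
  · exact safeA_2 .lose5 ⟨rfl, .inr ⟨hv, rfl⟩⟩ .refl .sL
  · exact safeA_2 .lose7 ⟨rfl, .inr ⟨hv, rfl⟩⟩ .refl .sL

theorem safeA_of_xw {m : M} (hb : b = .s1 ∨ b = .s9 ∨ b = .s11 ∨ b = .s12)
    (hv : pendingOn xw v = []) : SafeA L QF (simConf a b u v (msg m) mr my) := by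
  rcases hb with rfl | rfl | rfl | rfl
  · exact safeA_2 (.lose1 m) ⟨rfl, .inr ⟨hv, rfl⟩⟩ .refl .sL
  · exact safeA_2 (.lose9 m) ⟨rfl, .inr ⟨hv, rfl⟩⟩ .refl .sL
  · exact safeA_2 (.lose11 m) ⟨rfl, .inr ⟨hv, rfl⟩⟩ .refl .sL
  · exact safeA_2 (.lose12 m) ⟨rfl, .inr ⟨hv, rfl⟩⟩ .refl .sL

/-- These are the states that process 2 has to leave in a move of player B; if it is still there
when A is to move, she takes it to `sL`. -/
theorem safeA_of_nop {m : M} (hb : b = .sm m ∨ b = .s6 ∨ b = .s10) :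
    SafeA L QF (simConf a b u v mx mr my) := by
  rcases hb with rfl | rfl | rfl
  · exact safeA_2 (.lose3 m) rfl .refl .sL
  · exact safeA_2 .lose6 rfl .refl .sL
  · exact safeA_2 .lose10 rfl .refl .sL

variable {d : TSOConf SimProc SimVar (SimVal M) (SimState L)}

theorem safeA_of_updates_sL (h : Relation.ReflTransGen UpdateStep (simConf a .sL u v mx mr my) d) :
    SafeA L QF d := by
  obtain ⟨_, _, _, _, _, _, _, rfl, -⟩ := updates_simConf h
  exact safeA_sL

theorem safeA_of_updates_nop {m : M} (hb : b = .sm m ∨ b = .s6 ∨ b = .s10)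
    (h : Relation.ReflTransGen UpdateStep (simConf a b u v mx mr my) d) : SafeA L QF d := by
  obtain ⟨_, _, _, _, _, _, _, rfl, -⟩ := updates_simConf h
  exact safeA_of_nop hb

/-- After updates of a queue player A can either read a message from memory, or the buffer of
process 1 is unchanged. -/
theorem safeA_of_isQueue (hb : b = .s1 ∨ b = .s9 ∨ b = .s11 ∨ b = .s12) (hu : IsQueue u)
    (hv : pendingOn xw v = [])
    (h : Relation.ReflTransGen UpdateStep (simConf a b u v mx mr my) d)
    (hsafe : ∀ v' pv, v = v' ++ pv →
      SafeA L QF (simConf a b u v' mx (valAfter xr pv mr) (valAfter SimVar.y pv my))) :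
    SafeA L QF d := by
  rcases updates_of_isQueue h hu hv with ⟨v', pv, hv, rfl⟩ | ⟨u'', v', m, mr', my', hv, rfl⟩
  · exact hsafe v' pv hv
  · exact safeA_of_xw hb hv

theorem safeA_of_isAcked (hb : b = .s2 ∨ b = .s4 ∨ b = .s5 ∨ b = .s7) (hu : IsAcked u)
    (hv : pendingOn SimVar.y v = [])
    (h : Relation.ReflTransGen UpdateStep (simConf a b u v mx mr my) d)
    (hsafe : ∀ v' pv, v = v' ++ pv →
      SafeA L QF (simConf a b u v' (valAfter xw pv mx) (valAfter xr pv mr) my)) :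
    SafeA L QF d := by
  rcases updates_of_isAcked h hu hv with ⟨v', pv, hv, rfl⟩ | ⟨u'', v', mx', mr', hv, rfl⟩
  · exact hsafe v' pv hv
  · exact safeA_of_y hb hv

theorem safeA_of_isQueue_nil (hb : b = .s1 ∨ b = .s9 ∨ b = .s11 ∨ b = .s12) (hu : IsQueue u)
    (h : Relation.ReflTransGen UpdateStep (simConf a b u [] mx mr my) d)
    (hsafe : SafeA L QF (simConf a b u [] mx mr my)) : SafeA L QF d := by
  refine safeA_of_isQueue hb hu rfl h fun v' pv hv => ?_
  obtain ⟨rfl, rfl⟩ := List.append_eq_nil_iff.1 hv.symm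
  exact hsafe

theorem safeA_of_isAcked_nil (hb : b = .s2 ∨ b = .s4 ∨ b = .s5 ∨ b = .s7) (hu : IsAcked u)
    (h : Relation.ReflTransGen UpdateStep (simConf a b u [] mx mr my) d)
    (hsafe : SafeA L QF (simConf a b u [] mx mr my)) : SafeA L QF d := by
  refine safeA_of_isAcked hb hu rfl h fun v' pv hv => ?_
  obtain ⟨rfl, rfl⟩ := List.append_eq_nil_iff.1 hv.symm
  exact hsafe

theorem IsAcked.cons {u : List (SimVar × SimVal M)} (hu : IsAcked u) (hne : u ≠ []) (m : M) :
    IsAcked ((xw, msg m) :: u) := by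
  refine ⟨fun e he => ?_, fun u' e h => ?_⟩
  · rcases List.mem_cons.1 he with rfl | he
    · exact .inl ⟨m, rfl⟩
    · exact hu.1 e he
  · cases u' with
    | nil => simp at h; exact absurd h.2 hne
    | cons e' u' => simp at h; exact hu.2 u' e h.2

theorem PCS.ReachesFrom.head {c c' : Q × List M} (h : L.Step c c') (h' : L.ReachesFrom QF c') :
    L.ReachesFrom QF c := by
  obtain ⟨q, hq, w, h'⟩ := h'
  exact ⟨q, hq, w, .head h h'⟩

theorem PCS.reachesFrom_of_mem {q : Q} {w : List M} (h : q ∈ QF) : L.ReachesFrom QF (q, w) :=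
  ⟨q, h, w, .refl⟩

/-- A direct receive is blocked by the `⊥` in `xr`, and `q` is not in `QF`. If B begins a nop or a
send, A completes it. If B opens the receive cycle, he must have updated exactly one write. -/
theorem SafeB.safeA_of_move_s1 {q : Q} {w : List M} (hr : ¬ L.ReachesFrom QF (q, w))
    {c' : TSOConf SimProc SimVar (SimVal M) (SimState L)}
    (hc : InstrStep (simProgram L QF)
      (simConf (.chan q) .s1 (bufferOf w) [] bot bot zero) c')
    (hd : Relation.ReflTransGen UpdateStep c' d) : SafeA L QF d := by
  have hq := isQueue_bufferOf w
  rcases instrStep_simConf_iff.1 hc with ⟨ins, a', u', ht, he, rfl⟩ | ⟨ins, b', v', ht, he, rfl⟩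
  · cases ht with
    | nop_fst h =>
      obtain rfl := he
      exact safeA_of_isQueue_nil (.inl rfl) hq hd
        (safeA_1 (.nop_snd h) rfl .refl (.s1 fun h' => hr (h'.head (.nop h))))
    | send_fst h =>
      obtain rfl := he
      exact safeA_of_isQueue_nil (.inl rfl) (hq.cons _) hd
        (safeA_1 (.send_snd h) rfl .refl (.s1 (w := _ :: w) fun h' => hr (h'.head (.send h))))
    | recv_fst h => simp [Exec, hq.1.pendingOn_xr] at he
    | finish h => exact absurd (PCS.reachesFrom_of_mem h) hr
  · cases ht with
    | main1 =>
      obtain rfl := he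
      -- With an empty channel, or with no update, `xw` still holds `⊥`, and A reads this in `s2`.
      -- With more than one update the `1` behind the first message has reached `y`. Only the update
      -- of a single message leads to the safe state `sm m`.
      rcases List.eq_nil_or_concat w with rfl | ⟨w, m, rfl⟩
      · obtain ⟨u', v', pu, pv, mx', mr', my', rfl, hu, hv, hm⟩ := updates_simConf hd
        obtain ⟨rfl, rfl⟩ := List.append_eq_nil_iff.1 hv.symm
        obtain ⟨rfl, rfl⟩ := List.append_eq_nil_iff.1 hu.symm
        obtain rfl : mx' = bot := (hm xw).1 rfl
        exact safeA_2 .lose2 ⟨rfl, .inr ⟨rfl, rfl⟩⟩ .refl .sL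
      · rw [List.concat_eq_append] at *
        obtain ⟨u', v', pu, pv, mx', mr', my', rfl, hu, hv, hm⟩ := updates_simConf hd
        obtain ⟨rfl, rfl⟩ := List.append_eq_nil_iff.1 hv.symm
        have hmx := (hm xw).1 rfl
        have hmr := (hm xr).1 rfl
        have hmy := (hm SimVar.y).1 rfl
        simp only [simMem_xw, simMem_xr, simMem_y] at hmx hmr hmy
        rcases List.eq_nil_or_concat pu with rfl | ⟨pu, e, rfl⟩
        · obtain rfl : mx' = bot := hmx
          exact safeA_2 .lose2 ⟨rfl, .inr ⟨rfl, rfl⟩⟩ .refl .sL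
        · have hb : bufferOf (w ++ [m]) = (bufferOf w ++ [(SimVar.y, one)]) ++ [(xw, msg m)] := by
            simp [bufferOf_append]
          rw [List.concat_eq_append] at hmx hmr hmy
          rw [hb, List.concat_eq_append, ← List.append_assoc] at hu
          obtain ⟨hw, he⟩ := List.append_inj' hu rfl
          obtain rfl : (xw, msg m) = e := by simpa using he
          have hack := isAcked_bufferOf_append w
          by_cases hpu : pu = []
          · subst hpu
            rw [List.append_nil] at hw
            subst hw
            simp only [List.nil_append, valAfter_cons] at hmx hmr hmy
            simp only [valAfter_nil, reduceCtorEq, if_false, if_true] at hmx hmr hmy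
            subst hmx hmr hmy
            exact safeA_2 (.main2 m) ⟨rfl, .inr ⟨rfl, rfl⟩⟩ .refl (.sm hr)
          · rw [hw] at hack
            have hy := hack.valAfter_y hpu zero
            have : my' = one := by
              rw [hmy, ← hy]
              simp [valAfter, pendingOn]
            subst this
            exact safeA_of_y (.inl rfl) rfl
    | final1 => simp [Exec] at he
    | final1' => simp [Exec] at he
    | lose1 => exact safeA_of_updates_sL hd

/-- The only harmless move of B is the copy to `xr` without an update of process 1. Player A then
resets `xw` and flushes the whole buffer of process 2, so that the message is visible to process 1.
-/
theorem SafeB.safeA_of_move_sm {q : Q} {w : List M} {m : M}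
    (hr : ¬ L.ReachesFrom QF (q, w ++ [m]))
    {c' : TSOConf SimProc SimVar (SimVal M) (SimState L)}
    (hc : InstrStep (simProgram L QF)
      (simConf (.chan q) (.sm m) (bufferOf w ++ [(SimVar.y, one)]) [] (msg m) bot zero) c')
    (hd : Relation.ReflTransGen UpdateStep c' d) : SafeA L QF d := by
  have hack := isAcked_bufferOf_append w
  rcases instrStep_simConf_iff.1 hc with ⟨ins, a', u', ht, he, rfl⟩ | ⟨ins, b', v', ht, he, rfl⟩
  · exact safeA_of_updates_nop (.inl rfl) hd
  · cases ht with
    | main3 =>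
      obtain rfl := he
      refine safeA_of_isAcked (.inr (.inl rfl)) hack rfl hd fun v' pv hv => ?_
      rcases List.append_eq_singleton_iff.1 hv.symm with ⟨rfl, rfl⟩ | ⟨rfl, rfl⟩
      · exact safeA_2 .main4 rfl (simConf_flush_p2 _ _ [(xw, bot)] _ [] _ _ _) (.s5 hr)
      · exact safeA_2 .main4 rfl (simConf_flush_p2 _ _ [(xw, bot), (xr, msg m)] _ [] _ _ _)
          (.s5 hr)
    | final3 => simp [Exec] at he
    | lose3 => exact safeA_of_updates_sL hd

/-- Player B has to let process 1 receive the message just copied. If he begins a nop or a send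
instead, A can use the message in `xr` to drive process 1 into `hL`. A receive of a different
message is disabled. -/
theorem SafeB.safeA_of_move_s5 {q : Q} {w : List M} {m : M}
    (hr : ¬ L.ReachesFrom QF (q, w ++ [m]))
    {c' : TSOConf SimProc SimVar (SimVal M) (SimState L)}
    (hc : InstrStep (simProgram L QF)
      (simConf (.chan q) .s5 (bufferOf w ++ [(SimVar.y, one)]) [] bot (msg m) zero) c')
    (hd : Relation.ReflTransGen UpdateStep c' d) : SafeA L QF d := by
  have hack := isAcked_bufferOf_append w
  have hack' := fun m => hack.cons (by simp) m
  rcases instrStep_simConf_iff.1 hc with ⟨ins, a', u', ht, he, rfl⟩ | ⟨ins, b', v', ht, he, rfl⟩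
  · cases ht with
    | nop_fst h =>
      obtain rfl := he
      exact safeA_of_isAcked_nil (.inr (.inr (.inl rfl))) hack hd
        (safeA_1 (.nop_lose h m) ⟨rfl, .inr ⟨hack.1.pendingOn_xr, rfl⟩⟩ .refl (.hL hack))
    | send_fst h =>
      obtain rfl := he
      exact safeA_of_isAcked_nil (.inr (.inr (.inl rfl))) (hack' _) hd
        (safeA_1 (.send_lose h m) ⟨rfl, .inr ⟨(hack' _).1.pendingOn_xr, rfl⟩⟩ .refl (.hL (hack' _)))
    | @recv_fst _ _ m' h =>
      obtain ⟨rfl, hm⟩ := he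
      obtain rfl : m = m' := by simpa [hack.1.pendingOn_xr] using hm
      exact safeA_of_isAcked_nil (.inr (.inr (.inl rfl))) hack hd
        (safeA_2 .main5 rfl .refl (.s6 h fun h' => hr (h'.head (.recv h))))
    | finish h => exact absurd (PCS.reachesFrom_of_mem h) hr
  · cases ht with
    | main5 => exact safeA_of_updates_nop (m := m) (.inr (.inl rfl)) hd
    | final5 => simp [Exec] at he
    | lose5 => exact safeA_of_updates_sL hd

/-- Process 1 can only loop in `hL`, process 2 is punished in `s6` as soon as B moves it there, and
any update of process 1 puts a `1` into `y`. Otherwise A loops in `hL` as well. -/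
theorem SafeB.safeA_of_move_hL (hu : IsAcked u)
    {c' : TSOConf SimProc SimVar (SimVal M) (SimState L)}
    (hc : InstrStep (simProgram L QF) (simConf .hL .s5 u [] mx mr zero) c')
    (hd : Relation.ReflTransGen UpdateStep c' d) : SafeA L QF d := by
  rcases instrStep_simConf_iff.1 hc with ⟨ins, a', u', ht, he, rfl⟩ | ⟨ins, b', v', ht, he, rfl⟩
  · cases ht with
    | loop_hL =>
      obtain rfl := he
      exact safeA_of_isAcked_nil (.inr (.inr (.inl rfl))) hu hd
        (safeA_1 .loop_hL rfl .refl (.hL hu))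
  · cases ht with
    | main5 =>
      obtain ⟨_, _, _, _, _, _, _, rfl, -⟩ := updates_simConf hd
      exact safeA_2 .lose6 rfl .refl .sL
    | final5 => simp [Exec] at he
    | lose5 => exact safeA_of_updates_sL hd

theorem SafeB.safeA_of_move_recv {q : Q} {m : M} {q' : Q} {w : List M}
    (h : (q, .recv m, q') ∈ L.trans) (hr : ¬ L.ReachesFrom QF (q', w))
    {c' : TSOConf SimProc SimVar (SimVal M) (SimState L)}
    (hcase : b = .s6 ∧ u = bufferOf w ++ [(SimVar.y, one)] ∧ mr = msg m ∧ my = zero ∨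
      b = .s8 ∧ u = bufferOf w ∧ mr = msg m ∧ my = one ∨
      b = .s10 ∧ u = bufferOf w ∧ mr = msg m ∧ my = zero ∨
      b = .s12 ∧ u = bufferOf w ∧ mr = bot ∧ my = zero)
    (hc : InstrStep (simProgram L QF) (simConf (.aux ⟨_, h⟩) b u [] bot mr my) c')
    (hd : Relation.ReflTransGen UpdateStep c' d) : SafeA L QF d := by
  have hack := isAcked_bufferOf_append w
  have hq := isQueue_bufferOf w
  have hs : IsSends u := by
    rcases hcase with ⟨_, rfl, _⟩ | ⟨_, rfl, _⟩ | ⟨_, rfl, _⟩ | ⟨_, rfl, _⟩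
    exacts [hack.1, hq.1, hq.1, hq.1]
  rcases instrStep_simConf_iff.1 hc with ⟨ins, a', u', ht, he, rfl⟩ | ⟨ins, b', v', ht, he, rfl⟩
  · obtain ⟨rfl, rfl, rfl⟩ := exec_recv_snd ht hs he
    -- Process 1 can move only when `xr` holds `⊥`, that is, in `s12`. If B completes the transition
    -- there before the cycle is closed, A closes it, and the two orders lead to the same
    -- configuration.
    rcases hcase with ⟨_, _, h0, _⟩ | ⟨_, _, h0, _⟩ | ⟨_, _, h0, _⟩ | ⟨rfl, rfl, _, rfl⟩
    iterate 3 simp at h0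
    exact safeA_of_isQueue_nil (.inr (.inr (.inr rfl))) hq hd (safeA_2 .main12 rfl .refl (.s1 hr))
  · rcases hcase with ⟨rfl, rfl, rfl, rfl⟩ | ⟨rfl, rfl, rfl, rfl⟩ | ⟨rfl, rfl, rfl, rfl⟩ |
      ⟨rfl, rfl, rfl, rfl⟩
    · cases ht with
      | main6 =>
        obtain ⟨rfl, -⟩ := he
        exact safeA_of_isAcked_nil (.inr (.inr (.inr rfl))) hack hd
          (safeA_2 .main7 rfl (simConf_flush_p1 _ _ [(SimVar.y, one)] _ _ _ _ _) (.s8 h hr))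
      | final6 => simp [Exec] at he
      | lose6 => exact safeA_of_updates_sL hd
    · cases ht with
      | main8 =>
        obtain rfl := he
        refine safeA_of_isQueue (.inr (.inl rfl)) hq rfl hd fun v' pv hv => ?_
        rcases List.append_eq_singleton_iff.1 hv.symm with ⟨rfl, rfl⟩ | ⟨rfl, rfl⟩
        · exact safeA_2 .main9 rfl .refl (.s10 h hr)
        · exact safeA_2 .main9 rfl (simConf_flush_p2 _ _ [(SimVar.y, zero)] _ [] _ _ _) (.s10 h hr)
      | final8 => simp [Exec] at he
      | final8' => simp [Exec] at he
    · cases ht with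
      | main10 =>
        obtain ⟨rfl, -⟩ := he
        exact safeA_of_isQueue_nil (.inr (.inr (.inl rfl))) hq hd
          (safeA_2 .main11 rfl (simConf_flush_p2 _ _ [(xr, bot)] _ [] _ _ _) (.s12 h hr))
      | final10 => simp [Exec] at he
      | lose10 => exact safeA_of_updates_sL hd
    · cases ht with
      | main12 =>
        obtain rfl := he
        exact safeA_of_isQueue_nil (.inl rfl) hq hd
          (safeA_1 (.recv_snd h) ⟨rfl, .inr ⟨hq.1.pendingOn_xr, rfl⟩⟩ .refl (.s1 hr))
      | final12 => simp [Exec] at he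
      | lose12 => exact safeA_of_updates_sL hd

theorem SafeB.safeA_of_move {c c' : TSOConf SimProc SimVar (SimVal M) (SimState L)}
    (h : SafeB L QF c) (hc : InstrStep (simProgram L QF) c c')
    (hd : Relation.ReflTransGen UpdateStep c' d) : SafeA L QF d := by
  cases h with
  | sL =>
    rcases instrStep_simConf_iff.1 hc with ⟨ins, a', u', ht, he, rfl⟩ | ⟨ins, b', v', ht, he, rfl⟩
    · exact safeA_of_updates_sL hd
    · cases ht
      exact safeA_of_updates_sL hd
  | hL hu => exact safeA_of_move_hL hu hc hd
  | s1 hr => exact safeA_of_move_s1 hr hc hd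
  | sm hr => exact safeA_of_move_sm hr hc hd
  | s5 hr => exact safeA_of_move_s5 hr hc hd
  | s6 h hr => exact safeA_of_move_recv h hr (by simp) hc hd
  | s8 h hr => exact safeA_of_move_recv h hr (by simp) hc hd
  | s10 h hr => exact safeA_of_move_recv h hr (by simp) hc hd
  | s12 h hr => exact safeA_of_move_recv h hr (by simp) hc hd

/-- Process 2 cannot leave `sF`, and no configuration in `SafeB` has it there. -/
theorem SafeA.state_ne {c : TSOConf SimProc SimVar (SimVal M) (SimState L)} (h : SafeA L QF c) :
    c.state .p2 ≠ SimState2.sF := by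
  obtain ⟨c', hc, d, hd, h⟩ := h
  obtain ⟨a, b, u, v, mx, mr, my, rfl⟩ := exists_eq_simConf c
  rintro (rfl : b = .sF)
  have hs : c'.state .p2 = SimState2.sF := by
    rcases instrStep_simConf_iff.1 hc with ⟨_, _, _, _, _, rfl⟩ | ⟨_, _, _, ht, _, rfl⟩
    · rfl
    · cases ht
      rfl
  rw [← (updates_spec hd).1] at hs
  cases h <;> cases hs

theorem not_attr_of_not_reachesFrom {q : Q} {w : List M} (hr : ¬ L.ReachesFrom QF (q, w)) :
    ¬ (simGame L QF).Attr (.B, simConf (.chan q) .s1 (bufferOf w) [] bot bot zero) := by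
  refine SafetyGame.not_attr_of_trap (G := simGame L QF)
    (W := {g | g.1 = .A ∧ SafeA L QF g.2 ∨ g.1 = .B ∧ SafeB L QF g.2}) ?_ ?_ ?_ (.inr ⟨rfl, .s1 hr⟩)
  · rintro ⟨p, c⟩ (⟨rfl : p = _, h⟩ | ⟨rfl : p = _, h⟩) ⟨h1, i, hi⟩
    · cases i
      · exact hi
      · exact h.state_ne hi
    · cases h1
  · rintro ⟨p, c⟩ (⟨rfl : p = _, h⟩ | ⟨rfl : p = _, h⟩) ho
    · obtain ⟨c', hc, d, hd, h⟩ := h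
      exact ⟨(.B, d), .inr ⟨rfl, h⟩, rfl, c', hc, hd⟩
    · cases ho
  · rintro ⟨p, c⟩ (⟨rfl : p = _, h⟩ | ⟨rfl : p = _, h⟩) ho ⟨p', d⟩ ⟨rfl : p' = _, c', hc, hd⟩
    · cases ho
    · exact .inl ⟨rfl, h.safeA_of_move hc hd⟩

theorem attr_iff_reachesFrom {q : Q} {w : List M} :
    (simGame L QF).Attr (.B, simConf (.chan q) .s1 (bufferOf w) [] bot bot zero) ↔
      L.ReachesFrom QF (q, w) :=
  ⟨fun h => not_not.1 fun h' => not_attr_of_not_reachesFrom h' h, attr_of_reachesFrom⟩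

theorem reaches_iff_winsB (L : PCS Q M) (QF : Set Q) (q₀ : Q) :
    L.Reaches q₀ QF ↔ (simGame L QF).WinsB (.B, simInit L q₀) := by
  have h : simInit L q₀ = simConf (.chan q₀) .s1 (bufferOf []) [] bot bot zero := by
    unfold simInit simConf
    congr 1
    all_goals funext i; cases i <;> rfl
  refine Iff.trans ?_ simGame_deadlockFree.winsB_iff.symm
  rw [h]
  exact attr_iff_reachesFrom.symm

end Simulation

/-! ### Restriction of a channel system to a closed set of states -/

namespace PCS

variable {Q M : Type} (L : PCS Q M)

/-- Channels are written newest first, but the words of the stack simulation oldest first; hence the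
reversals. -/
theorem step_recv {q q' : Q} {m : M} (u : List M) (h : (q, .recv m, q') ∈ L.trans) :
    L.Step (q, (m :: u).reverse) (q', u.reverse) := by
  rw [List.reverse_cons]
  exact .recv h

theorem step_send {q q' : Q} {m : M} (u : List M) (h : (q, .send m, q') ∈ L.trans) :
    L.Step (q, u.reverse) (q', (u ++ [m]).reverse) := by
  rw [List.reverse_append]
  exact .send h

/-- The channel system with its states restricted to `T`. -/
def restrict (T : Set Q) : PCS T M := ⟨{t | (t.1.1, t.2.1, t.2.2.1) ∈ L.trans}⟩

/-- A run never leaves a set closed under transitions. This makes the system of a stack machine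
finite, since its states range over all statements. -/
theorem restrict_reachesFrom_iff {T : Set Q} (hT : ∀ q op q', (q, op, q') ∈ L.trans → q ∈ T → q' ∈ T)
    {QF : Set Q} {q : T} {w : List M} :
    (L.restrict T).ReachesFrom {q | q.1 ∈ QF} (q, w) ↔ L.ReachesFrom QF (q.1, w) := by
  constructor
  · rintro ⟨q', hq', w', h⟩
    refine ⟨q', hq', w', ?_⟩
    refine Relation.ReflTransGen.lift (r := (L.restrict T).Step)
      (fun c : T × List M => (c.1.1, c.2)) (fun c c' hc => ?_) _ _ h
    cases hc with
    | send h => exact .send h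
    | recv h => exact .recv h
    | nop h => exact .nop h
  · rintro ⟨q', hq', w', h⟩
    obtain ⟨q, hq⟩ := q
    generalize hc : ((⟨q, hq⟩ : T).1, w) = c at h
    induction h using Relation.ReflTransGen.head_induction_on generalizing q w with
    | refl => cases hc; exact ⟨⟨_, hq⟩, hq', w', .refl⟩
    | head hstep _ ih =>
      cases hstep with
      | send h =>
        cases hc
        exact (ih _ (hT _ _ _ h hq) rfl).head
          (Step.send (L := L.restrict T) (q := ⟨_, hq⟩) (q' := ⟨_, hT _ _ _ h hq⟩) h)
      | recv h =>
        cases hc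
        exact (ih _ (hT _ _ _ h hq) rfl).head
          (Step.recv (L := L.restrict T) (q := ⟨_, hq⟩) (q' := ⟨_, hT _ _ _ h hq⟩) h)
      | nop h =>
        cases hc
        exact (ih _ (hT _ _ _ h hq) rfl).head
          (Step.nop (L := L.restrict T) (q := ⟨_, hq⟩) (q' := ⟨_, hT _ _ _ h hq⟩) h)

end PCS

/-! ## A channel system that simulates a multi-stack machine -/

/-- A letter that occurs only once marks the starting point of a cyclic word: a nontrivial rotation
that has `x` in front again would have a second `x` in its tail. -/
theorem List.IsRotated.eq_of_notMem {α : Type*} {x : α} {l l' : List α} (h : (x :: l) ~r (x :: l'))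
    (hx : x ∉ l') : l = l' := by
  obtain ⟨n, hn, h⟩ := List.isRotated_iff_mod.1 h
  rw [List.rotate_eq_drop_append_take hn] at h
  cases n with
  | zero => simpa using h
  | succ n =>
    rw [List.drop_succ_cons, List.take_succ_cons] at h
    cases hd : l.drop n with
    | nil =>
      rw [hd, List.nil_append, List.cons.injEq] at h
      rw [← h.2, List.take_of_length_le (List.drop_eq_nil_iff.1 hd)]
    | cons y d =>
      rw [hd, List.cons_append, List.cons.injEq] at h
      exact absurd (h.2 ▸ by simp) hx

section Stacks

variable {K Γ : Type}

/-- The contents of the stacks, each preceded by a separator. -/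
def stackWord (ks : List K) (S : K → List Γ) : List (K × Option Γ) :=
  ks.flatMap fun k => (k, none) :: (S k).map fun g => (k, some g)

theorem stackWord_congr {ks : List K} {S S' : K → List Γ} (h : ∀ k ∈ ks, S k = S' k) :
    stackWord ks S = stackWord ks S' := by
  unfold stackWord
  rw [List.flatMap_def, List.flatMap_def]
  congr 1
  exact List.map_congr_left fun k hk => by rw [h k hk]

/-- Rotated so that the separator of `k` is in front, the word continues with stack `k`, then a
further separator, then a rest that does not depend on stack `k`. A second stack must exist for that
further separator, by which an empty stack `k` is recognised. -/
theorem exists_stackWord_isRotated [DecidableEq K] [Nontrivial K] {ks : List K} (hn : ks.Nodup)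
    (hks : ∀ k, k ∈ ks) (S : K → List Γ) (k : K) :
    ∃ k' R, (k, none) ∉ (k', none) :: R ∧ ∀ s, stackWord ks (Function.update S k s) ~r
      (k, none) :: (s.map (fun g => (k, some g)) ++ (k', none) :: R) := by
  obtain ⟨l₁, l₂, rfl⟩ := List.append_of_mem (hks k)
  have hk : k ∉ l₂ ++ l₁ := by
    have := List.nodup_middle.1 hn
    rw [List.nodup_cons, List.mem_append, or_comm, ← List.mem_append] at this
    exact this.1
  have hR : (k, none) ∉ stackWord (l₂ ++ l₁) S := by
    simp only [stackWord, List.mem_flatMap, List.mem_cons, List.mem_map, not_exists, not_and]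
    rintro k' hk' (h | ⟨g, -, h⟩)
    · exact hk ((Prod.mk.inj h).1 ▸ hk')
    · simp at h
  obtain ⟨k', ks', hks'⟩ : ∃ k' ks', l₂ ++ l₁ = k' :: ks' := by
    obtain ⟨k', hk'⟩ := exists_ne k
    have := hks k'
    cases h : l₂ ++ l₁ with
    | nil =>
      obtain ⟨rfl, rfl⟩ := List.append_eq_nil_iff.1 h
      simp [hk'] at this
    | cons a l => exact ⟨a, l, rfl⟩
  refine ⟨k', (S k').map (fun g => (k', some g)) ++ stackWord ks' S, ?_, fun s => ?_⟩
  · rw [hks'] at hR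
    simpa [stackWord] using hR
  · have h1 : stackWord (l₁ ++ k :: l₂) (Function.update S k s) =
        stackWord l₁ (Function.update S k s) ++ ((k, none) :: s.map (fun g => (k, some g)) ++
          stackWord l₂ (Function.update S k s)) := by
      simp [stackWord]
    have h2 : stackWord l₂ S ++ stackWord l₁ S =
        (k', none) :: ((S k').map (fun g => (k', some g)) ++ stackWord ks' S) := by
      have : stackWord (l₂ ++ l₁) S = stackWord l₂ S ++ stackWord l₁ S := by simp [stackWord]
      rw [← this, hks']
      simp [stackWord]
    have h3 : ∀ l, k ∉ l → stackWord l (Function.update S k s) = stackWord l S := by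
      intro l hl
      refine stackWord_congr fun j hj => Function.update_of_ne ?_ _ _
      rintro rfl
      exact hl hj
    rw [List.mem_append, not_or] at hk
    rw [h1, h3 _ hk.1, h3 _ hk.2, ← h2]
    refine List.isRotated_append.trans ?_
    simp [List.IsRotated.refl]

end Stacks

section StackMachine

open Turing

variable {K Γ Λ σ : Type}

/-- Statements of stack machines all of whose stacks have the same alphabet. -/
abbrev StackStmt (K Γ Λ σ : Type) : Type := TM2.Stmt (fun _ : K => Γ) Λ σ

/-- States of the channel system: `run q v` is about to execute `q`, `emit l q v` first sends `l`,
and `look q v` has received the separator of the stack that `q` wants to read. -/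
inductive StackState (K Γ Λ σ : Type) where
  | run (q : StackStmt K Γ Λ σ) (v : σ)
  | emit (l : List (K × Option Γ)) (q : StackStmt K Γ Λ σ) (v : σ)
  | look (q : StackStmt K Γ Λ σ) (v : σ)

open StackState TM2.Stmt

/-- The transitions of the channel system. -/
inductive StackTrans (m : Λ → StackStmt K Γ Λ σ) :
    StackState K Γ Λ σ → ChannelOp (K × Option Γ) → StackState K Γ Λ σ → Prop
  | rotate (q v x) : StackTrans m (run q v) (.recv x) (emit [x] q v)
  | emit_cons (x l q v) : StackTrans m (emit (x :: l) q v) (.send x) (emit l q v)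
  | emit_nil (q v) : StackTrans m (emit [] q v) .nop (run q v)
  | push (k f q v) : StackTrans m (run (push k f q) v) (.recv (k, none))
      (emit [(k, none), (k, some (f v))] q v)
  | pop (k f q v) : StackTrans m (run (pop k f q) v) (.recv (k, none)) (look (pop k f q) v)
  | pop_some (k f q v g) : StackTrans m (look (pop k f q) v) (.recv (k, some g))
      (emit [(k, none)] q (f v (some g)))
  | pop_none (k f q v k') : StackTrans m (look (pop k f q) v) (.recv (k', none))
      (emit [(k, none), (k', none)] q (f v none))
  | peek (k f q v) : StackTrans m (run (peek k f q) v) (.recv (k, none)) (look (peek k f q) v)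
  | peek_some (k f q v g) : StackTrans m (look (peek k f q) v) (.recv (k, some g))
      (emit [(k, none), (k, some g)] q (f v (some g)))
  | peek_none (k f q v k') : StackTrans m (look (peek k f q) v) (.recv (k', none))
      (emit [(k, none), (k', none)] q (f v none))
  | load (f q v) : StackTrans m (run (load f q) v) .nop (run q (f v))
  | branch (f q₁ q₂ v) : StackTrans m (run (branch f q₁ q₂) v) .nop (run (cond (f v) q₁ q₂) v)
  | goto (f v) : StackTrans m (run (goto f) v) .nop (run (m (f v)) v)

/-- The channel system of a stack machine. -/
def stackPCS (m : Λ → StackStmt K Γ Λ σ) : PCS (StackState K Γ Λ σ) (K × Option Γ) :=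
  ⟨{t | StackTrans m t.1 t.2.1 t.2.2}⟩

/-- The states in which the stack machine halts. -/
def stackFinal : Set (StackState K Γ Λ σ) := {s | ∃ v, s = run halt v}

theorem stackPCS_step_recv {m : Λ → StackStmt K Γ Λ σ} {s s' : StackState K Γ Λ σ}
    {x : K × Option Γ} (h : StackTrans m s (.recv x) s') (u : List (K × Option Γ)) :
    (stackPCS m).Step (s, (x :: u).reverse) (s', u.reverse) := PCS.step_recv _ u h

theorem stackPCS_step_nop {m : Λ → StackStmt K Γ Λ σ} {s s' : StackState K Γ Λ σ}
    (h : StackTrans m s .nop s') (w : List (K × Option Γ)) :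
    (stackPCS m).Step (s, w) (s', w) := PCS.Step.nop h

theorem reaches_emit {m : Λ → StackStmt K Γ Λ σ} (l : List (K × Option Γ))
    (q : StackStmt K Γ Λ σ) (v : σ) :
    ∀ u : List (K × Option Γ), Relation.ReflTransGen (stackPCS m).Step
      (emit l q v, u.reverse) (run q v, (u ++ l).reverse) := by
  induction l with
  | nil =>
    intro u
    simpa using Relation.ReflTransGen.single
      (stackPCS_step_nop (m := m) (.emit_nil q v) u.reverse)
  | cons x l ih =>
    intro u
    have := (ih (u ++ [x])).head
      (PCS.step_send (stackPCS m) u (StackTrans.emit_cons (m := m) x l q v))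
    simpa using this

theorem reaches_rotate {m : Λ → StackStmt K Γ Λ σ} (q : StackStmt K Γ Λ σ) (v : σ)
    {u u' : List (K × Option Γ)} (h : u ~r u') :
    Relation.ReflTransGen (stackPCS m).Step (run q v, u.reverse) (run q v, u'.reverse) := by
  obtain ⟨n, rfl⟩ := h
  induction n generalizing u with
  | zero => rw [List.rotate_zero]
  | succ n ih =>
    cases u with
    | nil => rw [List.rotate_nil]
    | cons x u =>
      rw [List.rotate_cons_succ]
      exact ((reaches_emit [x] q v u).head (stackPCS_step_recv (.rotate q v x) u)).trans ih

/-- The states of the channel system that use only the statements of labels in `A`. -/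
def stackStates (m : Λ → StackStmt K Γ Λ σ) (A : Finset Λ) : Set (StackState K Γ Λ σ)
  | run q _ => some q ∈ TM2.stmts m A
  | emit l q _ => l.length ≤ 2 ∧ some q ∈ TM2.stmts m A
  | look q _ => some q ∈ TM2.stmts m A

theorem finite_stackStates [Finite K] [Finite Γ] [Finite σ] (m : Λ → StackStmt K Γ Λ σ)
    (A : Finset Λ) : (stackStates m A).Finite := by
  have hq : {q | some q ∈ TM2.stmts m A}.Finite :=
    (TM2.stmts m A).finite_toSet.preimage (Option.some_injective _).injOn
  have hv := Set.finite_univ (α := σ)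
  have hl := List.finite_length_le (K × Option Γ) 2
  refine (((hq.prod hv).image fun p => run p.1 p.2).union
    (((hl.prod (hq.prod hv)).image fun p => emit p.1 p.2.1 p.2.2).union
      ((hq.prod hv).image fun p => look p.1 p.2))).subset ?_
  rintro (⟨q, v⟩ | ⟨l, q, v⟩ | ⟨q, v⟩) h
  · exact .inl ⟨(q, v), ⟨h, trivial⟩, rfl⟩
  · exact .inr (.inl ⟨(l, q, v), ⟨h.1, h.2, trivial⟩, rfl⟩)
  · exact .inr (.inr ⟨(q, v), ⟨h, trivial⟩, rfl⟩)

theorem some_mem_stmts {m : Λ → StackStmt K Γ Λ σ} {A : Finset Λ} {l : Λ}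
    {q : StackStmt K Γ Λ σ} (hl : l ∈ A) (h : q ∈ TM2.stmts₁ (m l)) : some q ∈ TM2.stmts m A := by
  have : ∃ l ∈ A, q ∈ TM2.stmts₁ (m l) := ⟨l, hl, h⟩
  simpa [TM2.stmts] using this

/-- All transitions except `goto` lead to substatements of the current statement or keep it; a
`goto` stays inside because `A` supports its statements. -/
theorem stackStates_closed {m : Λ → StackStmt K Γ Λ σ} {A : Finset Λ}
    (hA : ∀ l ∈ A, TM2.SupportsStmt A (m l))
    {s s' : StackState K Γ Λ σ} {op : ChannelOp (K × Option Γ)} (h : StackTrans m s op s')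
    (hs : s ∈ stackStates m A) : s' ∈ stackStates m A := by
  have sub : ∀ {q q' : StackStmt K Γ Λ σ}, some q ∈ TM2.stmts m A → q' ∈ TM2.stmts₁ q →
      some q' ∈ TM2.stmts m A := fun h h' => TM2.stmts_trans h' h
  cases h with
  | rotate => exact ⟨by simp, hs⟩
  | emit_cons x l => exact ⟨by have := hs.1; simp at this; omega, hs.2⟩
  | emit_nil => exact hs.2
  | push => exact ⟨by simp, sub hs (by simp [TM2.stmts₁, TM2.stmts₁_self])⟩
  | pop => exact hs
  | pop_some => exact ⟨by simp, sub hs (by simp [TM2.stmts₁, TM2.stmts₁_self])⟩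
  | pop_none => exact ⟨by simp, sub hs (by simp [TM2.stmts₁, TM2.stmts₁_self])⟩
  | peek => exact hs
  | peek_some => exact ⟨by simp, sub hs (by simp [TM2.stmts₁, TM2.stmts₁_self])⟩
  | peek_none => exact ⟨by simp, sub hs (by simp [TM2.stmts₁, TM2.stmts₁_self])⟩
  | load => exact sub hs (by simp [TM2.stmts₁, TM2.stmts₁_self])
  | branch f q₁ q₂ v =>
    refine sub hs ?_
    cases f v <;> simp [TM2.stmts₁, TM2.stmts₁_self]
  | goto f v =>
    have hsup : TM2.SupportsStmt A (goto f : StackStmt K Γ Λ σ) := by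
      obtain ⟨l, hl, h⟩ : ∃ l ∈ A, (goto f : StackStmt K Γ Λ σ) ∈ TM2.stmts₁ (m l) := by
        have hs : some (goto f : StackStmt K Γ Λ σ) ∈ TM2.stmts m A := hs
        simpa [TM2.stmts] using hs
      exact TM2.stmts₁_supportsStmt_mono h (hA l hl)
    exact some_mem_stmts (hsup v) TM2.stmts₁_self

variable [DecidableEq K]

/-- The machine halts when started at statement `q`. -/
def Halts (m : Λ → StackStmt K Γ Λ σ) (q : StackStmt K Γ Λ σ) (v : σ) (S : K → List Γ) : Prop :=
  ∃ c, StateTransition.Reaches (TM2.step m) (TM2.stepAux q v S) c ∧ c.l = none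

/-- The configuration of the channel system (with the oldest message first) represents a
configuration of the machine. -/
inductive StackRep (ks : List K) : StackState K Γ Λ σ → List (K × Option Γ) →
    StackStmt K Γ Λ σ → σ → (K → List Γ) → Prop
  | run {q v u S} : u ~r stackWord ks S → StackRep ks (run q v) u q v S
  | emit {l q v u S} : (u ++ l) ~r stackWord ks S → StackRep ks (emit l q v) u q v S
  | pop {k f q v u S} : ((k, none) :: u) ~r stackWord ks S →
      StackRep ks (look (pop k f q) v) u (pop k f q) v S
  | peek {k f q v u S} : ((k, none) :: u) ~r stackWord ks S →
      StackRep ks (look (peek k f q) v) u (peek k f q) v S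

variable [Nontrivial K] {ks : List K} {m : Λ → StackStmt K Γ Λ σ}

/-- The separator of `k` occurs only once, so by `List.IsRotated.eq_of_notMem` a channel that starts
with it is known exactly: the stack `k` comes next and can be replaced in place. -/
theorem exists_eq_of_isRotated_stackWord (hn : ks.Nodup) (hks : ∀ k, k ∈ ks) {S : K → List Γ}
    {k : K} {u : List (K × Option Γ)} (h : ((k, none) :: u) ~r stackWord ks S) :
    ∃ k' R, u = (S k).map (fun g => (k, some g)) ++ (k', none) :: R ∧
      ∀ s, ((k, none) :: (s.map (fun g => (k, some g)) ++ (k', none) :: R)) ~r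
        stackWord ks (Function.update S k s) := by
  obtain ⟨k', R, hR, hs⟩ := exists_stackWord_isRotated hn hks S k
  refine ⟨k', R, ?_, fun s => (hs s).symm⟩
  have h' := hs (S k)
  rw [Function.update_eq_self] at h'
  refine (h.trans h').eq_of_notMem ?_
  rw [List.mem_append, not_or]
  exact ⟨by simp, hR⟩

/-- The channel system is nondeterministic because it may rotate at will, but every step either
keeps the represented configuration or executes one statement of the machine. Therefore halting can
be pulled back along any run, including one that rotates superfluously. -/
theorem StackRep.step (hn : ks.Nodup) (hks : ∀ k, k ∈ ks) {s s' : StackState K Γ Λ σ}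
    {u u' : List (K × Option Γ)} {q : StackStmt K Γ Λ σ} {v : σ} {S : K → List Γ}
    (h : StackRep ks s u q v S) {op : ChannelOp (K × Option Γ)} (ht : StackTrans m s op s')
    (hu : match op with
      | .recv x => u = x :: u'
      | .send x => u' = u ++ [x]
      | .nop => u' = u) :
    ∃ q' v' S', StackRep ks s' u' q' v' S' ∧ (Halts m q' v' S' → Halts m q v S) := by
  cases ht with
  | rotate q v x =>
    obtain rfl := hu
    cases h with
    | run h =>
      exact ⟨q, v, S, .emit ((List.IsRotated.cons_append_singleton).symm.trans h), id⟩
  | emit_cons x l q v =>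
    obtain rfl := hu
    cases h with
    | emit h => exact ⟨q, v, S, .emit (by simpa using h), id⟩
  | emit_nil q v =>
    obtain rfl := hu
    cases h with
    | emit h => exact ⟨q, v, S, .run (by simpa using h), id⟩
  | push k f q v =>
    obtain rfl := hu
    cases h with
    | run h =>
      obtain ⟨k', R, rfl, hs⟩ := exists_eq_of_isRotated_stackWord hn hks h
      refine ⟨q, v, Function.update S k (f v :: S k), .emit ?_, id⟩
      refine List.IsRotated.trans ?_ (hs _)
      exact List.isRotated_append.trans (by simp [List.IsRotated.refl])
  | pop k f q v =>
    obtain rfl := hu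
    cases h with
    | run h => exact ⟨_, v, S, .pop h, id⟩
  | pop_some k f q v g =>
    obtain rfl := hu
    cases h with
    | pop h =>
      obtain ⟨k', R, he, hs⟩ := exists_eq_of_isRotated_stackWord hn hks h
      cases hS : S k with
      | nil => simp [hS] at he
      | cons g' s =>
        simp only [hS, List.map_cons, List.cons_append, List.cons.injEq, Prod.mk.injEq, true_and,
          Option.some.injEq] at he
        obtain ⟨rfl, rfl⟩ := he
        refine ⟨q, _, Function.update S k s, .emit ?_, ?_⟩
        · exact List.isRotated_append.trans (hs s)
        · intro hh; simpa [Halts, hS] using hh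
  | pop_none k f q v k₀ =>
    obtain rfl := hu
    cases h with
    | pop h =>
      obtain ⟨k', R, he, hs⟩ := exists_eq_of_isRotated_stackWord hn hks h
      cases hS : S k with
      | nil =>
        refine ⟨q, _, S, .emit ?_, ?_⟩
        · exact List.isRotated_append.trans (by simpa using h)
        · have : Function.update S k [] = S := by rw [← hS, Function.update_eq_self]
          intro hh; simpa [Halts, hS, this] using hh
      | cons g' s => simp [hS] at he
  | peek k f q v =>
    obtain rfl := hu
    cases h with
    | run h => exact ⟨_, v, S, .peek h, id⟩
  | peek_some k f q v g =>
    obtain rfl := hu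
    cases h with
    | peek h =>
      obtain ⟨k', R, he, hs⟩ := exists_eq_of_isRotated_stackWord hn hks h
      cases hS : S k with
      | nil => simp [hS] at he
      | cons g' s =>
        simp only [hS, List.map_cons, List.cons_append, List.cons.injEq, Prod.mk.injEq, true_and,
          Option.some.injEq] at he
        obtain ⟨rfl, rfl⟩ := he
        refine ⟨q, _, S, .emit ?_, ?_⟩
        · exact List.isRotated_append.trans (by simpa using h)
        · intro hh; simpa [Halts, hS] using hh
  | peek_none k f q v k₀ =>
    obtain rfl := hu
    cases h with
    | peek h =>
      obtain ⟨k', R, he, hs⟩ := exists_eq_of_isRotated_stackWord hn hks h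
      cases hS : S k with
      | nil =>
        refine ⟨q, _, S, .emit ?_, ?_⟩
        · exact List.isRotated_append.trans (by simpa using h)
        · intro hh; simpa [Halts, hS] using hh
      | cons g' s => simp [hS] at he
  | load f q v =>
    obtain rfl := hu
    cases h with
    | run h => exact ⟨q, f v, S, .run h, id⟩
  | branch f q₁ q₂ v =>
    obtain rfl := hu
    cases h with
    | run h =>
      refine ⟨_, v, S, .run h, ?_⟩
      cases hf : f v <;> simp [Halts, hf]
  | goto f v =>
    obtain rfl := hu
    cases h with
    | run h =>
      refine ⟨_, v, S, .run h, ?_⟩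
      rintro ⟨c, hc, hl⟩
      exact ⟨c, Relation.ReflTransGen.head rfl hc, hl⟩

theorem halts_of_reachesFrom (hn : ks.Nodup) (hks : ∀ k, k ∈ ks) {s : StackState K Γ Λ σ}
    {w : List (K × Option Γ)} {q : StackStmt K Γ Λ σ} {v : σ} {S : K → List Γ}
    (h : (stackPCS m).ReachesFrom stackFinal (s, w)) (hr : StackRep ks s w.reverse q v S) :
    Halts m q v S := by
  obtain ⟨_, ⟨v', rfl⟩, w', h⟩ := h
  generalize hc : (s, w) = c at h
  induction h using Relation.ReflTransGen.head_induction_on generalizing s w q v S with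
  | refl =>
    cases hc
    cases hr
    exact ⟨_, .refl, rfl⟩
  | head hstep _ ih =>
    cases hstep with
    | send ht =>
      cases hc
      obtain ⟨q', v', S', hr', hh⟩ := hr.step hn hks ht (List.reverse_cons)
      exact hh (ih hr' rfl)
    | recv ht =>
      cases hc
      obtain ⟨q', v', S', hr', hh⟩ := hr.step hn hks ht (by simp; rfl)
      exact hh (ih hr' rfl)
    | nop ht =>
      cases hc
      obtain ⟨q', v', S', hr', hh⟩ := hr.step hn hks ht rfl
      exact hh (ih hr' rfl)

/-- The state that represents an optional label. -/
def labelState (m : Λ → StackStmt K Γ Λ σ) (l : Option Λ) (v : σ) : StackState K Γ Λ σ :=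
  run (l.elim halt m) v

/-- For the converse, the system rotates the needed separator to the front before each stack
operation. -/
theorem reaches_stepAux (hn : ks.Nodup) (hks : ∀ k, k ∈ ks) (q : StackStmt K Γ Λ σ) :
    ∀ (v : σ) (S : K → List Γ) (u : List (K × Option Γ)), u ~r stackWord ks S →
    ∃ u', u' ~r stackWord ks (TM2.stepAux q v S).stk ∧ Relation.ReflTransGen (stackPCS m).Step
      (run q v, u.reverse)
      (labelState m (TM2.stepAux q v S).l (TM2.stepAux q v S).var, u'.reverse) := by
  have key : ∀ (S : K → List Γ) (k : K), ∃ u, ((k, none) :: u) ~r stackWord ks S := by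
    intro S k
    obtain ⟨k', R, -, hs⟩ := exists_stackWord_isRotated hn hks S k
    exact ⟨_, by simpa using (hs (S k)).symm⟩
  induction q with
  | push k f q ih =>
    intro v S u hu
    obtain ⟨u₁, hu₁⟩ := key S k
    obtain ⟨k', R, rfl, hs⟩ := exists_eq_of_isRotated_stackWord hn hks hu₁
    obtain ⟨u', hu', hr⟩ := ih v (Function.update S k (f v :: S k))
      ((S k).map (fun g => (k, some g)) ++ (k', none) :: R ++ [(k, none), (k, some (f v))])
      (List.IsRotated.trans (List.isRotated_append.trans (by simp [List.IsRotated.refl]))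
        (hs (f v :: S k)))
    refine ⟨u', hu', (reaches_rotate _ v (hu.trans hu₁.symm)).trans (.trans ?_ hr)⟩
    exact (reaches_emit [(k, none), (k, some (f v))] q v _).head
      (stackPCS_step_recv (.push k f q v) _)
  | pop k f q ih =>
    intro v S u hu
    obtain ⟨u₁, hu₁⟩ := key S k
    obtain ⟨k', R, rfl, hs⟩ := exists_eq_of_isRotated_stackWord hn hks hu₁
    have h1 := (reaches_rotate (m := m) (pop k f q) v (hu.trans hu₁.symm)).tail
      (stackPCS_step_recv (.pop k f q v) _)
    cases hS : S k with
    | nil =>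
      rw [hS] at hu₁
      obtain ⟨u', hu', hr⟩ := ih (f v none) S (R ++ [(k, none), (k', none)])
        (List.IsRotated.trans (List.isRotated_append.trans (by simp [List.IsRotated.refl])) hu₁)
      have hup : Function.update S k [] = S := by rw [← hS, Function.update_eq_self]
      simp only [TM2.stepAux, hS, List.head?_nil, List.tail_nil, hup]
      refine ⟨u', hu', h1.trans (.trans ?_ hr)⟩
      rw [hS]
      exact (reaches_emit [(k, none), (k', none)] q _ _).head
        (stackPCS_step_recv (.pop_none k f q v k') _)
    | cons g s =>
      obtain ⟨u', hu', hr⟩ := ih (f v (some g)) (Function.update S k s)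
        (s.map (fun g => (k, some g)) ++ (k', none) :: R ++ [(k, none)])
        (List.isRotated_append.trans (hs s))
      simp only [TM2.stepAux, hS, List.head?_cons, List.tail_cons]
      refine ⟨u', hu', h1.trans (.trans ?_ hr)⟩
      rw [hS]
      exact (reaches_emit [(k, none)] q _ _).head
        (stackPCS_step_recv (.pop_some k f q v g) _)
  | peek k f q ih =>
    intro v S u hu
    obtain ⟨u₁, hu₁⟩ := key S k
    obtain ⟨k', R, rfl, hs⟩ := exists_eq_of_isRotated_stackWord hn hks hu₁
    have h1 := (reaches_rotate (m := m) (peek k f q) v (hu.trans hu₁.symm)).tail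
      (stackPCS_step_recv (.peek k f q v) _)
    cases hS : S k with
    | nil =>
      rw [hS] at hu₁
      obtain ⟨u', hu', hr⟩ := ih (f v none) S (R ++ [(k, none), (k', none)])
        (List.IsRotated.trans (List.isRotated_append.trans (by simp [List.IsRotated.refl])) hu₁)
      simp only [TM2.stepAux, hS, List.head?_nil]
      refine ⟨u', hu', h1.trans (.trans ?_ hr)⟩
      rw [hS]
      exact (reaches_emit [(k, none), (k', none)] q _ _).head
        (stackPCS_step_recv (.peek_none k f q v k') _)
    | cons g s =>
      rw [hS] at hu₁
      obtain ⟨u', hu', hr⟩ := ih (f v (some g)) S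
        (s.map (fun g => (k, some g)) ++ (k', none) :: R ++ [(k, none), (k, some g)])
        (List.IsRotated.trans (List.isRotated_append.trans (by simp [List.IsRotated.refl])) hu₁)
      simp only [TM2.stepAux, hS, List.head?_cons]
      refine ⟨u', hu', h1.trans (.trans ?_ hr)⟩
      rw [hS]
      exact (reaches_emit [(k, none), (k, some g)] q _ _).head
        (stackPCS_step_recv (.peek_some k f q v g) _)
  | load f q ih =>
    intro v S u hu
    obtain ⟨u', hu', hr⟩ := ih (f v) S u hu
    exact ⟨u', hu', hr.head (stackPCS_step_nop (.load f q v) _)⟩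
  | branch f q₁ q₂ ih₁ ih₂ =>
    intro v S u hu
    have h1 := stackPCS_step_nop (m := m) (.branch f q₁ q₂ v) u.reverse
    cases hf : f v with
    | true =>
      rw [hf] at h1
      obtain ⟨u', hu', hr⟩ := ih₁ v S u hu
      simp only [TM2.stepAux, hf, cond_true]
      exact ⟨u', hu', hr.head h1⟩
    | false =>
      rw [hf] at h1
      obtain ⟨u', hu', hr⟩ := ih₂ v S u hu
      simp only [TM2.stepAux, hf, cond_false]
      exact ⟨u', hu', hr.head h1⟩
  | goto f => exact fun v S u hu => ⟨u, hu, .single (stackPCS_step_nop (.goto f v) _)⟩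
  | halt => exact fun v S u hu => ⟨u, hu, .refl⟩

theorem reachesFrom_of_reaches (hn : ks.Nodup) (hks : ∀ k, k ∈ ks)
    {c c' : TM2.Cfg (fun _ : K => Γ) Λ σ} (h : StateTransition.Reaches (TM2.step m) c c')
    (hl : c'.l = none) : ∀ u, u ~r stackWord ks c.stk →
    (stackPCS m).ReachesFrom stackFinal (labelState m c.l c.var, u.reverse) := by
  induction h using Relation.ReflTransGen.head_induction_on with
  | refl =>
    intro u hu
    rw [hl]
    exact PCS.reachesFrom_of_mem ⟨_, rfl⟩
  | @head c d hstep _ ih =>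
    intro u hu
    obtain ⟨l, v, S⟩ := c
    cases l with
    | none => cases hstep
    | some l =>
      obtain rfl : TM2.stepAux (m l) v S = d := Option.some.inj hstep
      obtain ⟨u', hu', hr⟩ := reaches_stepAux (m := m) hn hks (m l) v S u hu
      obtain ⟨q, hq, w, hw⟩ := ih u' hu'
      exact ⟨q, hq, w, hr.trans hw⟩

theorem reachesFrom_iff_halts (hn : ks.Nodup) (hks : ∀ k, k ∈ ks) (q : StackStmt K Γ Λ σ) (v : σ)
    (S : K → List Γ) :
    (stackPCS m).ReachesFrom stackFinal (run q v, (stackWord ks S).reverse) ↔ Halts m q v S := by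
  constructor
  · intro h
    exact halts_of_reachesFrom hn hks h (.run (by rw [List.reverse_reverse]))
  · rintro ⟨c, hc, hl⟩
    obtain ⟨u', hu', hr⟩ := reaches_stepAux (m := m) hn hks q v S _ (.refl _)
    obtain ⟨q, hq, w, hw⟩ := reachesFrom_of_reaches hn hks hc hl u' hu'
    exact ⟨q, hq, w, hr.trans hw⟩

end StackMachine

/-! ## Undecidability of reachability in channel systems -/

/-! ### The binary digits of the input are primitive recursive -/

section Digits

open Turing PartrecToTM2

theorem trPosNum_eq (p : PosNum) :
    trPosNum p = (if (p : ℕ) % 2 = 0 then Γ'.bit0 else Γ'.bit1) :: trNat ((p : ℕ) / 2) := by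
  cases p with
  | one => simp [trPosNum]
  | bit0 p =>
    have h : ((PosNum.bit0 p : PosNum) : ℕ) = 2 * (p : ℕ) := by rw [PosNum.cast_bit0]; ring
    rw [h, if_pos (by omega), Nat.mul_div_cancel_left _ (by norm_num), trNat, PosNum.of_to_nat]
    rfl
  | bit1 p =>
    have h : ((PosNum.bit1 p : PosNum) : ℕ) = 2 * (p : ℕ) + 1 := by rw [PosNum.cast_bit1]; ring
    have h' : (2 * (p : ℕ) + 1) / 2 = p := by omega
    rw [h, if_neg (by omega), h', trNat, PosNum.of_to_nat]
    rfl

theorem trNat_eq {n : ℕ} (hn : n ≠ 0) :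
    trNat n = (if n % 2 = 0 then Γ'.bit0 else Γ'.bit1) :: trNat (n / 2) := by
  have h : ((n : Num) : ℕ) = n := Num.to_of_nat n
  cases hp : (n : Num) with
  | zero => rw [hp] at h; exact absurd h.symm hn
  | pos p =>
    have hpn : (p : ℕ) = n := by rw [hp] at h; exact h
    rw [trNat, hp, ← hpn]
    exact trPosNum_eq p

/-- The digits of `n` are its parity followed by the digits of `n / 2`. An arbitrary numbering `e`
of the stack symbols avoids any choice of coding for the alphabet. -/
theorem primrec_map_trNat (e : Γ' → ℕ) : Primrec fun n => (trNat n).map e := by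
  -- The list `l` contains the values at all numbers below `n`, so `n` is its length.
  have hg : Primrec₂ fun (_ : Unit) (l : List (List ℕ)) => if l.length = 0 then some [] else
      (l[l.length / 2]?).map fun t =>
        (if l.length % 2 = 0 then e Γ'.bit0 else e Γ'.bit1) :: t := by
    have hlen : Primrec fun p : Unit × List (List ℕ) => p.2.length :=
      Primrec.list_length.comp Primrec.snd
    refine Primrec.ite (Primrec.eq.comp hlen (Primrec.const 0)) (Primrec.const _)
      (Primrec.option_map (Primrec.list_getElem?.comp Primrec.snd
        (Primrec.nat_div.comp hlen (Primrec.const 2))) ?_)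
    refine Primrec.list_cons.comp (Primrec.ite (Primrec.eq.comp (Primrec.nat_mod.comp
      (hlen.comp Primrec.fst) (Primrec.const 2)) (Primrec.const 0)) (Primrec.const _)
      (Primrec.const _)) Primrec.snd
  have := Primrec.nat_strong_rec (fun (_ : Unit) n => (trNat n).map e) hg ?_
  · exact this.comp (Primrec.const ()) Primrec.id
  · intro _ n
    by_cases hn : n = 0
    · subst hn; simp
    · have hlt : n / 2 < n := Nat.div_lt_self (Nat.pos_of_ne_zero hn) (by norm_num)
      rw [trNat_eq hn]
      simp only [List.length_map, List.length_range, hn, if_false, List.getElem?_map,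
        List.getElem?_range hlt, Option.map_some, List.map_cons]
      split_ifs <;> rfl

end Digits

/-! ### From the halting problem to channel systems -/

section Halting

open Turing PartrecToTM2

/-- The stacks of the machines that evaluate partial recursive functions. -/
def machineStacks : List K' := [.main, .rev, .aux, .stack]

theorem mem_machineStacks (k : K') : k ∈ machineStacks := by cases k <;> simp [machineStacks]

instance : Finite K' :=
  Set.finite_univ_iff.1 (machineStacks.finite_toSet.subset fun k _ => mem_machineStacks k)

instance : Nontrivial K' := ⟨.main, .rev, by decide⟩

theorem halts_iff_eval_dom (c : ToPartrec.Code) (v : List ℕ) :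
    Halts tr (tr (trNormal c .halt)) none (K'.elim (trList v) [] [] []) ↔ (c.eval v).Dom := by
  have h1 : (c.eval v).Dom ↔ (StateTransition.eval (TM2.step tr) (init c v)).Dom := by
    rw [tr_eval]
    rfl
  rw [h1, Part.dom_iff_mem]
  constructor
  · rintro ⟨⟨l, x, S⟩, hc, rfl : l = none⟩
    -- `Halts` starts after the first step of the machine, which executes the statement of the
    -- initial label; that step is added here and split off in the converse.
    exact ⟨_, StateTransition.mem_eval.2 ⟨Relation.ReflTransGen.head rfl hc, rfl⟩⟩
  · rintro ⟨⟨l, x, S⟩, hc⟩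
    obtain ⟨hr, hn⟩ := StateTransition.mem_eval.1 hc
    cases l with
    | some l => cases hn
    | none =>
      rcases Relation.ReflTransGen.cases_head hr with h | ⟨d, hd, hr⟩
      · cases h
      · obtain rfl := Option.some.inj hd
        exact ⟨_, hr, rfl⟩

/-- Evaluation at `0` of the code numbered `n` is one partial recursive function of `n`, so a single
machine, and later a single channel system, suffices; only its input varies. -/
theorem exists_undecidable_code : ∃ c : ToPartrec.Code,
    ¬ ComputablePred fun n : ℕ => (c.eval [n]).Dom := by
  have hp : Partrec fun n : ℕ => Nat.Partrec.Code.eval (Denumerable.ofNat Nat.Partrec.Code n) 0 :=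
    Nat.Partrec.Code.eval_part.comp (Computable.ofNat _) (Computable.const 0)
  obtain ⟨c, hc⟩ := ToPartrec.Code.exists_code (Nat.Partrec'.part_iff₁.2 hp)
  refine ⟨c, fun h => ComputablePred.halting_problem 0 ?_⟩
  obtain ⟨f, hf, h⟩ := ComputablePred.computable_iff.1 h
  refine ComputablePred.computable_iff.2 ⟨fun d => f (Encodable.encode d),
    hf.comp Computable.encode, funext fun d => ?_⟩
  rw [← congrFun h (Encodable.encode d)]
  have := hc ⟨[Encodable.encode d], rfl⟩
  simp only [List.Vector.head, Denumerable.ofNat_encode] at this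
  change _ = (c.eval [Encodable.encode d]).Dom
  rw [this]
  rfl

theorem exists_undecidable_pcs : ∃ (Q M : Type) (_ : Finite Q) (_ : Finite M) (L : PCS Q M)
    (QF : Set Q) (q : Q) (w : ℕ → List M), (∀ e : M → ℕ, Primrec fun n => (w n).map e) ∧
      ¬ ComputablePred fun n => L.ReachesFrom QF (q, w n) := by
  obtain ⟨c, hc⟩ := exists_undecidable_code
  set A := codeSupp c .halt
  have hA : ∀ l ∈ A, TM2.SupportsStmt A (tr l) := (tr_supports c .halt).2
  have hstart : trNormal c .halt ∈ A := (tr_supports c .halt).1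
  have hq : StackState.run (tr (trNormal c .halt)) none ∈ stackStates tr A :=
    some_mem_stmts (m := tr) hstart TM2.stmts₁_self
  have hfin : Finite (stackStates tr A) := finite_stackStates tr A
  refine ⟨stackStates tr A, K' × Option Γ', hfin, inferInstance, (stackPCS tr).restrict _,
    {s | s.1 ∈ stackFinal}, ⟨_, hq⟩,
    fun n => (stackWord machineStacks (K'.elim (trList [n]) [] [] [])).reverse, fun e => ?_, ?_⟩
  -- Only the digits of `n` vary; the other symbols are the end mark `cons` of the number and the
  -- separators of the four stacks.
  · have h : ∀ n, ((stackWord machineStacks (K'.elim (trList [n]) [] [] [])).reverse).map e =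
        ([e (.main, none)] ++ ((trNat n).map (fun g => e (.main, some g)) ++
          [e (.main, some .cons), e (.rev, none), e (.aux, none), e (.stack, none)])).reverse := by
      intro n
      simp [stackWord, machineStacks, K'.elim, Function.comp_def]
    refine Primrec.of_eq ?_ fun n => (h n).symm
    exact Primrec.list_reverse.comp (Primrec.list_append.comp (Primrec.const _)
      (Primrec.list_append.comp (primrec_map_trNat _) (Primrec.const _)))
  · intro h
    refine hc (h.of_eq fun n => ?_)
    refine (PCS.restrict_reachesFrom_iff (stackPCS tr) fun _ _ _ h hs =>
      stackStates_closed (m := tr) hA h hs).trans ?_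
    exact (reachesFrom_iff_halts (m := tr) (by decide) mem_machineStacks _ none _).trans
      (halts_iff_eval_dom c [n])

end Halting

/-! ## Renaming the constituents of a program -/

theorem Instr.map_injective {X D X' D' : Type} {f : X → X'} {g : D → D'}
    (hf : Function.Injective f) (hg : Function.Injective g) : Function.Injective (Instr.map f g) := by
  intro a b h
  cases a <;> cases b <;> simp_all [Instr.map, hf.eq_iff, hg.eq_iff]

section Renaming

variable {I X D I' X' D' : Type} {S : I → Type} {S' : I' → Type}

/-- Bijections between the constituents of two programs that respect transitions and final
states. -/
structure Renaming (P : Program I X D S) (F : (i : I) → Set (S i)) (P' : Program I' X' D' S')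
    (F' : (i : I') → Set (S' i)) where
  proc : I ≃ I'
  var : X ≃ X'
  val : D ≃ D'
  loc : (i : I) → S i ≃ S' (proc i)
  trans_iff : ∀ i s ins s', (loc i s, Instr.map var val ins, loc i s') ∈ P'.trans (proc i) ↔
    (s, ins, s') ∈ P.trans i
  final_iff : ∀ i s, loc i s ∈ F' (proc i) ↔ s ∈ F i

namespace Renaming

variable {P : Program I X D S} {F : (i : I) → Set (S i)} {P' : Program I' X' D' S'}
  {F' : (i : I') → Set (S' i)} (e : Renaming P F P' F')

/-- Renaming of a pending write. -/
def write (m : X × D) : X' × D' := (e.var m.1, e.val m.2)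

/-- `c'` is the renamed configuration `c`. -/
def Rel (c : TSOConf I X D S) (c' : TSOConf I' X' D' S') : Prop :=
  (∀ i, c'.state (e.proc i) = e.loc i (c.state i)) ∧
  (∀ i, c'.buffer (e.proc i) = (c.buffer i).map e.write) ∧
  ∀ x, c'.memory (e.var x) = e.val (c.memory x)

theorem exists_rel (c' : TSOConf I' X' D' S') : ∃ c, e.Rel c c' :=
  ⟨⟨fun i => (e.loc i).symm (c'.state (e.proc i)),
    fun i => (c'.buffer (e.proc i)).map fun m => (e.var.symm m.1, e.val.symm m.2),
    fun x => e.val.symm (c'.memory (e.var x))⟩,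
    fun i => by simp, fun i => by simp [write, Function.comp_def], fun x => by simp⟩

variable {e} {c : TSOConf I X D S} {c' : TSOConf I' X' D' S'}

theorem pendingOn_map [DecidableEq X] [DecidableEq X'] (x : X) (b : List (X × D)) :
    pendingOn (e.var x) (b.map e.write) = (pendingOn x b).map e.write := by
  unfold pendingOn
  rw [List.filter_map]
  congr 2
  funext m
  simp [write]

theorem update_state [DecidableEq I] [DecidableEq I'] (h : e.Rel c c') (i : I) (s : S i) (j : I) :
    Function.update c'.state (e.proc i) (e.loc i s) (e.proc j) =
      e.loc j (Function.update c.state i s j) := by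
  by_cases hj : j = i
  · subst hj; simp
  · rw [Function.update_of_ne hj, Function.update_of_ne (e.proc.injective.ne hj), h.1]

theorem update_buffer [DecidableEq I] [DecidableEq I'] (h : e.Rel c c') (i : I)
    (b : List (X × D)) (j : I) :
    Function.update c'.buffer (e.proc i) (b.map e.write) (e.proc j) =
      (Function.update c.buffer i b j).map e.write := by
  by_cases hj : j = i
  · subst hj; simp
  · rw [Function.update_of_ne hj, Function.update_of_ne (e.proc.injective.ne hj), h.2.1]

theorem update_memory [DecidableEq X] [DecidableEq X'] (h : e.Rel c c') (x : X) (d : D) (z : X) :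
    Function.update c'.memory (e.var x) (e.val d) (e.var z) =
      e.val (Function.update c.memory x d z) := by
  by_cases hj : z = x
  · subst hj; simp
  · rw [Function.update_of_ne hj, Function.update_of_ne (e.var.injective.ne hj), h.2.2]

variable [DecidableEq I] [DecidableEq X] [DecidableEq I'] [DecidableEq X']

theorem instrStep_forth {d : TSOConf I X D S} (h : e.Rel c c') (hs : InstrStep P c d) :
    ∃ d', InstrStep P' c' d' ∧ e.Rel d d' := by
  have ht : ∀ {i ins s'}, (c.state i, ins, s') ∈ P.trans i →
      (c'.state (e.proc i), Instr.map e.var e.val ins, e.loc i s') ∈ P'.trans (e.proc i) := by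
    intro i ins s' ht
    rw [h.1]
    exact (e.trans_iff ..).2 ht
  have hb : ∀ {i}, c.buffer i = [] → c'.buffer (e.proc i) = [] := by
    intro i hb
    rw [h.2.1, hb, List.map_nil]
  have hp : ∀ {i x}, pendingOn (e.var x) (c'.buffer (e.proc i)) =
      (pendingOn x (c.buffer i)).map e.write := by
    intro i x
    rw [h.2.1, pendingOn_map]
  cases hs with
  | readOwnWrite i t hw =>
    exact ⟨_, .readOwnWrite _ (ht t) (by rw [hp, hw]; rfl), update_state h _ _, h.2.1, h.2.2⟩
  | readFromMemory i t hw hm =>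
    exact ⟨_, .readFromMemory _ (ht t) (by rw [hp, hw]; rfl) (by rw [h.2.2, hm]),
      update_state h _ _, h.2.1, h.2.2⟩
  | @write i x v s' t =>
    refine ⟨_, .write _ (ht t), update_state h _ _, ?_, h.2.2⟩
    rw [h.2.1]
    exact fun j => update_buffer h i ((x, v) :: c.buffer i) j
  | arw i t hw hm =>
    exact ⟨_, .arw _ (ht t) (hb hw) (by rw [h.2.2, hm]), update_state h _ _, h.2.1,
      update_memory h _ _⟩
  | skip i t => exact ⟨_, .skip _ (ht t), update_state h _ _, h.2.1, h.2.2⟩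
  | fence i t hw => exact ⟨_, .fence _ (ht t) (hb hw), update_state h _ _, h.2.1, h.2.2⟩

theorem instrStep_back {d' : TSOConf I' X' D' S'} (h : e.Rel c c') (hs : InstrStep P' c' d') :
    ∃ d, InstrStep P c d ∧ e.Rel d d' := by
  have ht : ∀ {i ins s'}, (c'.state (e.proc i), Instr.map e.var e.val ins, e.loc i s') ∈
      P'.trans (e.proc i) → (c.state i, ins, s') ∈ P.trans i := by
    intro i ins s' ht
    rw [h.1] at ht
    exact (e.trans_iff ..).1 ht
  have hb : ∀ {i}, c'.buffer (e.proc i) = [] → c.buffer i = [] := by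
    intro i hb
    rwa [h.2.1, List.map_eq_nil_iff] at hb
  have hp : ∀ {i x}, pendingOn (e.var x) (c'.buffer (e.proc i)) =
      (pendingOn x (c.buffer i)).map e.write := by
    intro i x
    rw [h.2.1, pendingOn_map]
  cases hs with
  | @readOwnWrite i' x' v' s' w t hw =>
    obtain ⟨i, rfl⟩ := e.proc.surjective i'
    obtain ⟨x, rfl⟩ := e.var.surjective x'
    obtain ⟨v, rfl⟩ := e.val.surjective v'
    obtain ⟨s, rfl⟩ := (e.loc i).surjective s'
    rw [hp, List.map_eq_cons_iff] at hw
    obtain ⟨⟨x₁, v₁⟩, w', hw, hm, -⟩ := hw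
    simp only [Renaming.write, Prod.mk.injEq, e.var.injective.eq_iff, e.val.injective.eq_iff] at hm
    obtain ⟨rfl, rfl⟩ := hm
    exact ⟨_, .readOwnWrite i (ht (ins := .read _ _) t) hw, update_state h _ _, h.2.1, h.2.2⟩
  | @readFromMemory i' x' v' s' t hw hm =>
    obtain ⟨i, rfl⟩ := e.proc.surjective i'
    obtain ⟨x, rfl⟩ := e.var.surjective x'
    obtain ⟨v, rfl⟩ := e.val.surjective v'
    obtain ⟨s, rfl⟩ := (e.loc i).surjective s'
    rw [hp, List.map_eq_nil_iff] at hw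
    rw [h.2.2, e.val.injective.eq_iff] at hm
    exact ⟨_, .readFromMemory i (ht (ins := .read _ _) t) hw hm, update_state h _ _, h.2.1, h.2.2⟩
  | @write i' x' v' s' t =>
    obtain ⟨i, rfl⟩ := e.proc.surjective i'
    obtain ⟨x, rfl⟩ := e.var.surjective x'
    obtain ⟨v, rfl⟩ := e.val.surjective v'
    obtain ⟨s, rfl⟩ := (e.loc i).surjective s'
    refine ⟨_, .write i (ht (ins := .write _ _) t), update_state h _ _, ?_, h.2.2⟩
    rw [h.2.1]
    exact fun j => update_buffer h i ((x, v) :: c.buffer i) j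
  | @arw i' x' v' u' s' t hw hm =>
    obtain ⟨i, rfl⟩ := e.proc.surjective i'
    obtain ⟨x, rfl⟩ := e.var.surjective x'
    obtain ⟨v, rfl⟩ := e.val.surjective v'
    obtain ⟨u, rfl⟩ := e.val.surjective u'
    obtain ⟨s, rfl⟩ := (e.loc i).surjective s'
    rw [h.2.2, e.val.injective.eq_iff] at hm
    exact ⟨_, .arw i (ht (ins := .arw _ _ _) t) (hb hw) hm, update_state h _ _, h.2.1,
      update_memory h _ _⟩
  | @skip i' s' t =>
    obtain ⟨i, rfl⟩ := e.proc.surjective i'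
    obtain ⟨s, rfl⟩ := (e.loc i).surjective s'
    exact ⟨_, .skip i (ht (ins := .nop) t), update_state h _ _, h.2.1, h.2.2⟩
  | @fence i' s' t hw =>
    obtain ⟨i, rfl⟩ := e.proc.surjective i'
    obtain ⟨s, rfl⟩ := (e.loc i).surjective s'
    exact ⟨_, .fence i (ht (ins := .fence) t) (hb hw), update_state h _ _, h.2.1, h.2.2⟩

theorem updates_forth {d : TSOConf I X D S} (h : e.Rel c c')
    (hs : Relation.ReflTransGen UpdateStep c d) :
    ∃ d', Relation.ReflTransGen UpdateStep c' d' ∧ e.Rel d d' := by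
  induction hs with
  | refl => exact ⟨c', .refl, h⟩
  | tail _ hs ih =>
    obtain ⟨d', hd, hr⟩ := ih
    cases hs with
    | update i hb =>
      exact ⟨_, hd.tail (.update (e.proc i) (by rw [hr.2.1, hb, List.map_append]; rfl)), hr.1,
        update_buffer hr i _, update_memory hr _ _⟩

theorem updates_back {d' : TSOConf I' X' D' S'} (h : e.Rel c c')
    (hs : Relation.ReflTransGen UpdateStep c' d') :
    ∃ d, Relation.ReflTransGen UpdateStep c d ∧ e.Rel d d' := by
  induction hs with
  | refl => exact ⟨c, .refl, h⟩
  | tail _ hs ih =>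
    obtain ⟨d, hd, hr⟩ := ih
    cases hs with
    | @update i' x' v' w hb =>
      obtain ⟨i, rfl⟩ := e.proc.surjective i'
      rw [hr.2.1, List.map_eq_append_iff] at hb
      obtain ⟨w', l, hb, rfl, hl⟩ := hb
      rw [List.map_eq_singleton_iff] at hl
      obtain ⟨⟨x, v⟩, rfl, hxv⟩ := hl
      cases hxv
      exact ⟨_, hd.tail (.update i hb), hr.1, update_buffer hr i _, update_memory hr _ _⟩

variable (e) in
/-- The relation between the configurations of the two games. -/
def GameRel (g : (abtsoGame P F).Conf) (g' : (abtsoGame P' F').Conf) : Prop :=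
  g.1 = g'.1 ∧ e.Rel g.2 g'.2

theorem move_forth {g h : (abtsoGame P F).Conf} {g' : (abtsoGame P' F').Conf}
    (hr : e.GameRel g g') (hm : (abtsoGame P F).move g h) :
    ∃ h', (abtsoGame P' F').move g' h' ∧ e.GameRel h h' := by
  obtain ⟨ho, c, hc, hd⟩ := hm
  obtain ⟨c', hc', hr'⟩ := instrStep_forth hr.2 hc
  obtain ⟨d', hd', hr''⟩ := updates_forth hr' hd
  exact ⟨(h.1, d'), ⟨ho.trans (by rw [hr.1]), c', hc', hd'⟩, rfl, hr''⟩

theorem move_back {g : (abtsoGame P F).Conf} {g' h' : (abtsoGame P' F').Conf}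
    (hr : e.GameRel g g') (hm : (abtsoGame P' F').move g' h') :
    ∃ h, (abtsoGame P F).move g h ∧ e.GameRel h h' := by
  obtain ⟨ho, c', hc', hd'⟩ := hm
  obtain ⟨c, hc, hr'⟩ := instrStep_back hr.2 hc'
  obtain ⟨d, hd, hr''⟩ := updates_back hr' hd'
  exact ⟨(h'.1, d), ⟨ho.trans (by rw [hr.1]), c, hc, hd⟩, rfl, hr''⟩

theorem final_iff_of_gameRel {g : (abtsoGame P F).Conf} {g' : (abtsoGame P' F').Conf}
    (hr : e.GameRel g g') : g ∈ (abtsoGame P F).final ↔ g' ∈ (abtsoGame P' F').final := by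
  refine and_congr (by rw [hr.1]) ⟨?_, ?_⟩
  · rintro ⟨i, hi⟩
    exact ⟨e.proc i, by rw [hr.2.1]; exact (e.final_iff ..).2 hi⟩
  · rintro ⟨i', hi⟩
    obtain ⟨i, rfl⟩ := e.proc.surjective i'
    rw [hr.2.1] at hi
    exact ⟨i, (e.final_iff ..).1 hi⟩

/-- `GameRel` is a bisimulation that respects owners and final configurations, so the attractors
correspond in both directions. -/
theorem attr_iff {g : (abtsoGame P F).Conf} {g' : (abtsoGame P' F').Conf} (hr : e.GameRel g g') :
    (abtsoGame P F).Attr g ↔ (abtsoGame P' F').Attr g' :=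
  ⟨SafetyGame.attr_of_bisim (R := e.GameRel) (fun _ _ h => h.1)
      (fun _ _ h => (final_iff_of_gameRel h).1) (fun _ _ _ => move_forth)
      (fun _ _ _ => move_back) hr,
    SafetyGame.attr_of_bisim (R := fun g' g => e.GameRel g g') (fun _ _ h => h.1.symm)
      (fun _ _ h => (final_iff_of_gameRel h).2) (fun _ _ _ => move_back)
      (fun _ _ _ => move_forth) hr⟩

theorem deadlockFree (e : Renaming P F P' F') (h : (abtsoGame P F).DeadlockFree) :
    (abtsoGame P' F').DeadlockFree := by
  rintro ⟨p, c'⟩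
  obtain ⟨c, hc⟩ := e.exists_rel c'
  obtain ⟨d, hd⟩ := h (p, c)
  obtain ⟨d', hd', -⟩ := move_forth (g := (p, c)) (g' := (p, c')) ⟨rfl, hc⟩ hd
  exact ⟨d', hd'⟩

end Renaming

end Renaming

/-! ## Channel systems as instances of the safety problem -/

section Finiteness

variable {Q M : Type}

instance [Finite M] : Finite (SimVal M) :=
  Finite.of_surjective
    (fun t : M ⊕ Fin 4 => match t with
      | .inl m => SimVal.msg m
      | .inr 0 => .zero
      | .inr 1 => .one
      | .inr 2 => .bot
      | .inr 3 => .top) (by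
    rintro (m | _ | _ | _ | _)
    exacts [⟨.inl m, rfl⟩, ⟨.inr 0, rfl⟩, ⟨.inr 1, rfl⟩, ⟨.inr 2, rfl⟩, ⟨.inr 3, rfl⟩])

instance [Finite M] : Finite (ChannelOp M) :=
  Finite.of_surjective
    (fun t : M ⊕ M ⊕ Unit => match t with
      | .inl m => ChannelOp.send m
      | .inr (.inl m) => .recv m
      | .inr (.inr _) => .nop) (by
    rintro (m | m | _)
    exacts [⟨.inl m, rfl⟩, ⟨.inr (.inl m), rfl⟩, ⟨.inr (.inr ()), rfl⟩])

instance [Finite Q] [Finite M] (L : PCS Q M) : Finite (SimState1 L) :=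
  Finite.of_surjective
    (fun t : Q ⊕ L.trans ⊕ Bool => match t with
      | .inl q => SimState1.chan q
      | .inr (.inl t) => .aux t
      | .inr (.inr true) => .hL
      | .inr (.inr false) => .hF) (by
    rintro (q | t | _ | _)
    exacts [⟨.inl q, rfl⟩, ⟨.inr (.inl t), rfl⟩, ⟨.inr (.inr true), rfl⟩,
      ⟨.inr (.inr false), rfl⟩])

instance [Finite M] : Finite (SimState2 M) :=
  Finite.of_surjective
    (fun t : M ⊕ Fin 13 => match t with
      | .inl m => SimState2.sm m
      | .inr 0 => .s1
      | .inr 1 => .s2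
      | .inr 2 => .s4
      | .inr 3 => .s5
      | .inr 4 => .s6
      | .inr 5 => .s7
      | .inr 6 => .s8
      | .inr 7 => .s9
      | .inr 8 => .s10
      | .inr 9 => .s11
      | .inr 10 => .s12
      | .inr 11 => .sF
      | .inr 12 => .sL) (by
    rintro (_ | _ | m | _ | _ | _ | _ | _ | _ | _ | _ | _ | _ | _)
    exacts [⟨.inr 0, rfl⟩, ⟨.inr 1, rfl⟩, ⟨.inl m, rfl⟩, ⟨.inr 2, rfl⟩, ⟨.inr 3, rfl⟩,
      ⟨.inr 4, rfl⟩, ⟨.inr 5, rfl⟩, ⟨.inr 6, rfl⟩, ⟨.inr 7, rfl⟩, ⟨.inr 8, rfl⟩, ⟨.inr 9, rfl⟩,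
      ⟨.inr 10, rfl⟩, ⟨.inr 11, rfl⟩, ⟨.inr 12, rfl⟩])

instance {X D : Type} [Finite X] [Finite D] : Finite (Instr X D) :=
  Finite.of_equiv _ (instrEquiv X D).symm

end Finiteness

/-- The numbering of the shared variables. -/
def simVarEquiv : SimVar ≃ Fin 3 where
  toFun
    | .xw => 0
    | .xr => 1
    | .y => 2
  invFun
    | 0 => .xw
    | 1 => .xr
    | 2 => .y
  left_inv := by rintro (_ | _ | _) <;> rfl
  right_inv := by intro i; fin_cases i <;> rfl

theorem Instr.map_map {X D X' D' X'' D'' : Type} (f : X → X') (g : D → D') (f' : X' → X'')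
    (g' : D' → D'') (ins : Instr X D) :
    Instr.map f' g' (Instr.map f g ins) = Instr.map (f' ∘ f) (g' ∘ g) ins := by
  cases ins <;> rfl

/-- A finite set of transitions as a list of numbers. -/
theorem exists_list_of_trans {A X D : Type} [Finite A] [Finite X] [Finite D] {n x d : ℕ}
    (eA : A → Fin n) (eX : X → Fin x) (eD : D → Fin d) (T : A → Instr X D → A → Prop) :
    ∃ l : List (ℕ × Instr ℕ ℕ × ℕ), ∀ t, t ∈ l ↔ ∃ a ins a', T a ins a' ∧
      t = ((eA a).val, Instr.map Fin.val Fin.val (Instr.map eX eD ins), (eA a').val) := by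
  have hfin : {t : A × Instr X D × A | T t.1 t.2.1 t.2.2}.Finite := Set.toFinite _
  refine ⟨((hfin.image fun t => ((eA t.1).val, Instr.map Fin.val Fin.val (Instr.map eX eD t.2.1),
    (eA t.2.2).val)).toFinset).toList, fun t => ?_⟩
  rw [Finset.mem_toList, Set.Finite.mem_toFinset]
  constructor
  · rintro ⟨⟨a, ins, a'⟩, h, rfl⟩
    exact ⟨a, ins, a', h, rfl⟩
  · rintro ⟨a, ins, a', h, rfl⟩
    exact ⟨(a, ins, a'), h, rfl⟩

theorem mem_list_of_trans_iff {A X D : Type} {n x d : ℕ} (eA : A ≃ Fin n) (eX : X ≃ Fin x)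
    (eD : D ≃ Fin d) {T : A → Instr X D → A → Prop} {l : List (ℕ × Instr ℕ ℕ × ℕ)}
    (hl : ∀ t, t ∈ l ↔ ∃ a ins a', T a ins a' ∧
      t = ((eA a).val, Instr.map Fin.val Fin.val (Instr.map eX eD ins), (eA a').val))
    (a : A) (ins : Instr X D) (a' : A) :
    ((eA a).val, Instr.map Fin.val Fin.val (Instr.map eX eD ins), (eA a').val) ∈ l ↔
      T a ins a' := by
  rw [hl]
  constructor
  · rintro ⟨b, ins', b', h, he⟩
    rw [Prod.mk.injEq, Prod.mk.injEq, Fin.val_inj, Fin.val_inj, eA.injective.eq_iff,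
      eA.injective.eq_iff, (Instr.map_injective Fin.val_injective Fin.val_injective).eq_iff,
      (Instr.map_injective eX.injective eD.injective).eq_iff] at he
    obtain ⟨rfl, rfl, rfl⟩ := he
    exact h
  · exact fun h => ⟨a, ins, a', h, rfl⟩

/-- A numbering of the states and values of the program of a channel system, together with the
lists of its transitions. -/
structure SimNumbering {Q M : Type} (L : PCS Q M) (QF : Set Q) where
  numVals : ℕ
  num1 : ℕ
  num2 : ℕ
  val : SimVal M ≃ Fin numVals
  loc1 : SimState1 L ≃ Fin num1
  loc2 : SimState2 M ≃ Fin num2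
  list1 : List (ℕ × Instr ℕ ℕ × ℕ)
  list2 : List (ℕ × Instr ℕ ℕ × ℕ)
  mem_list1 : ∀ t, t ∈ list1 ↔ ∃ a ins a', SimTrans1 L QF a ins a' ∧
    t = ((loc1 a).val, Instr.map Fin.val Fin.val (Instr.map simVarEquiv val ins), (loc1 a').val)
  mem_list2 : ∀ t, t ∈ list2 ↔ ∃ a ins a', SimTrans2 M a ins a' ∧
    t = ((loc2 a).val, Instr.map Fin.val Fin.val (Instr.map simVarEquiv val ins), (loc2 a').val)

namespace SimNumbering

variable {Q M : Type} {L : PCS Q M} {QF : Set Q}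

theorem nonempty [Finite Q] [Finite M] (L : PCS Q M) (QF : Set Q) :
    Nonempty (SimNumbering L QF) := by
  obtain ⟨d, ⟨val⟩⟩ := Finite.exists_equiv_fin (SimVal M)
  obtain ⟨n₁, ⟨loc1⟩⟩ := Finite.exists_equiv_fin (SimState1 L)
  obtain ⟨n₂, ⟨loc2⟩⟩ := Finite.exists_equiv_fin (SimState2 M)
  have : Finite SimVar := Finite.of_equiv _ simVarEquiv.symm
  obtain ⟨l₁, h₁⟩ := exists_list_of_trans loc1 simVarEquiv val (SimTrans1 L QF)
  obtain ⟨l₂, h₂⟩ := exists_list_of_trans loc2 simVarEquiv val (SimTrans2 M)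
  exact ⟨⟨d, n₁, n₂, val, loc1, loc2, l₁, l₂, h₁, h₂⟩⟩

variable (e : SimNumbering L QF)

/-- The number of a pending write. -/
def write (m : SimVar × SimVal M) : ℕ × ℕ := ((simVarEquiv m.1).val, (e.val m.2).val)

/-- The instance with process 1 in state `q` and the pending writes `u`. -/
def inst (q : Q) (u : List (ℕ × ℕ)) : SafetyInstance where
  numVars := 3
  numVals := e.numVals
  procs := [(e.num1, e.list1), (e.num2, e.list2)]
  finals := [(1, (e.loc2 .sF).val)]
  turn := .B
  states := [(e.loc1 (.chan q)).val, (e.loc2 .s1).val]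
  buffers := [u, []]
  memory := [(e.val .bot).val, (e.val .bot).val, (e.val .zero).val]

variable (q : Q) (u : List (ℕ × ℕ))

/-- The numbering of the processes. -/
def proc : SimProc ≃ (e.inst q u).Proc where
  toFun
    | .p1 => (0 : Fin 2)
    | .p2 => (1 : Fin 2)
  invFun := fun (i : Fin 2) => match i with
    | 0 => .p1
    | 1 => .p2
  left_inv := by rintro (_ | _) <;> rfl
  right_inv := by
    intro (i : Fin 2)
    fin_cases i <;> rfl

/-- The numbering of the local states. -/
def loc : (i : SimProc) → SimState L i ≃ (e.inst q u).LocalState (e.proc q u i)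
  | .p1 => e.loc1
  | .p2 => e.loc2

/-- The numbering as a renaming. -/
def toRenaming : Renaming (simProgram L QF) (simFinal L) (e.inst q u).program
    (e.inst q u).finalStates where
  proc := e.proc q u
  var := simVarEquiv
  val := e.val
  loc := e.loc q u
  trans_iff i s ins s' := by
    cases i
    · exact mem_list_of_trans_iff e.loc1 simVarEquiv e.val e.mem_list1 s ins s'
    · exact mem_list_of_trans_iff e.loc2 simVarEquiv e.val e.mem_list2 s ins s'
  final_iff i s := by
    cases i
    · change ((0 : ℕ), _) ∈ [((1 : ℕ), _)] ↔ False
      simp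
    · change ((1 : ℕ), (e.loc2 s).val) ∈ [((1 : ℕ), (e.loc2 .sF).val)] ↔ s = .sF
      simp [Fin.val_inj]

theorem inRange : (e.inst q u).InRange := by
  constructor
  · intro (i : Fin 2) t ht
    fin_cases i
    · obtain ⟨a, ins, a', h, rfl⟩ := (e.mem_list1 t).1 ht
      exact ⟨(e.loc1 a, Instr.map simVarEquiv e.val ins, e.loc1 a'), ht, rfl⟩
    · obtain ⟨a, ins, a', h, rfl⟩ := (e.mem_list2 t).1 ht
      exact ⟨(e.loc2 a, Instr.map simVarEquiv e.val ins, e.loc2 a'), ht, rfl⟩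
  · intro f hf
    obtain rfl : f = (1, (e.loc2 .sF).val) := List.mem_singleton.1 hf
    exact ⟨(1 : Fin 2), e.loc2 .sF, rfl⟩

/-- The numbered configuration. -/
def conf (c : TSOConf SimProc SimVar (SimVal M) (SimState L)) :
    TSOConf (e.inst q u).Proc (Fin (e.inst q u).numVars) (Fin (e.inst q u).numVals)
      (e.inst q u).LocalState where
  state := fun (i : Fin 2) => match i with
    | 0 => e.loc1 (c.state .p1)
    | 1 => e.loc2 (c.state .p2)
  buffer := fun (i : Fin 2) => match i with
    | 0 => (c.buffer .p1).map (e.toRenaming q u).write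
    | 1 => (c.buffer .p2).map (e.toRenaming q u).write
  memory x := e.val (c.memory (simVarEquiv.symm x))

theorem rel_conf (c : TSOConf SimProc SimVar (SimVal M) (SimState L)) :
    (e.toRenaming q u).Rel c (e.conf q u c) := by
  refine ⟨?_, ?_, ?_⟩
  · rintro (_ | _) <;> rfl
  · rintro (_ | _) <;> rfl
  · rintro (_ | _ | _) <;> rfl

open SimVal in
theorem represents (w : List M) :
    (e.inst q ((bufferOf w).map e.write)).Represents (e.conf q _
      (simConf (.chan q) .s1 (bufferOf w) [] bot bot zero)) := by
  refine ⟨rfl, ?_, rfl⟩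
  change [(bufferOf w).map e.write, []] =
    [((bufferOf w).map (e.toRenaming q _).write).map fun m => (m.1.val, m.2.val), []]
  rw [List.map_map]
  rfl

open SimVal in
theorem isValid (w : List M) :
    (e.inst q ((bufferOf w).map e.write)).IsValid (e.conf q _
      (simConf (.chan q) .s1 (bufferOf w) [] bot bot zero)) :=
  ⟨e.inRange q _, e.represents q w, (e.toRenaming q _).deadlockFree simGame_deadlockFree⟩

open SimVal in
theorem winsA_iff (w : List M) :
    (e.inst q ((bufferOf w).map e.write)).game.WinsA (.B, e.conf q _
      (simConf (.chan q) .s1 (bufferOf w) [] bot bot zero)) ↔ ¬ L.ReachesFrom QF (q, w) := by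
  refine Iff.trans ((e.toRenaming q _).deadlockFree simGame_deadlockFree).winsA_iff ?_
  rw [← attr_iff_reachesFrom]
  exact not_congr (Renaming.attr_iff (e := e.toRenaming q _) ⟨rfl, e.rel_conf q _ _⟩).symm

/-- The program, its numbering and every other field are constants; only the store buffer of process
1 depends on `n`. -/
theorem computable_inst {w : ℕ → List M} (hw : ∀ f : M → ℕ, Primrec fun n => (w n).map f) :
    Computable fun n => e.inst q ((bufferOf (w n)).map e.write) := by
  have hbuf : Primrec fun n => (bufferOf (w n)).map e.write := by
    -- The block of a message with number `j`; the `0` in front of `j` is the number of `xw` under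
    -- `simVarEquiv`.
    have h1 : Primrec₂ fun (_ : ℕ) (j : ℕ) => [e.write (.y, .one), (0, j)] :=
      Primrec.list_cons.comp (Primrec.const _)
        (Primrec.list_cons.comp (Primrec.pair (Primrec.const 0) Primrec.snd) (Primrec.const []))
    refine (Primrec.list_flatMap (hw fun m => (e.val (.msg m)).val) h1).of_eq fun n => ?_
    rw [List.flatMap_map]
    unfold bufferOf
    rw [List.map_flatMap]
    rfl
  have hsym : Primrec safetyInstanceEquiv.symm := Primrec.of_equiv_symm
  refine Primrec.to_comp (hsym.comp (g := fun n => ((3 : ℕ), e.numVals,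
    [(e.num1, e.list1), (e.num2, e.list2)], [(1, (e.loc2 .sF).val)], Player.B,
    [(e.loc1 (.chan q)).val, (e.loc2 .s1).val], [(bufferOf (w n)).map e.write, []],
    [(e.val .bot).val, (e.val .bot).val, (e.val .zero).val])) ?_)
  exact (Primrec.const _).pair ((Primrec.const _).pair ((Primrec.const _).pair
    ((Primrec.const _).pair ((Primrec.const _).pair ((Primrec.const _).pair
      ((Primrec.list_cons.comp hbuf (Primrec.const _)).pair (Primrec.const _)))))))

end SimNumbering

/-! ### Undecidability of the safety problem -/

theorem not_ABTSOSafetyDecidable : ¬ ABTSOSafetyDecidable := by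
  rintro ⟨f, hf, hdec⟩
  obtain ⟨Q, M, _, _, L, QF, q, w, hw, hL⟩ := exists_undecidable_pcs
  obtain ⟨e⟩ := SimNumbering.nonempty L QF
  have h : ∀ n, ∃ b ∈ f (e.inst q ((bufferOf (w n)).map e.write)),
      (b = true ↔ ¬ L.ReachesFrom QF (q, w n)) := by
    intro n
    obtain ⟨b, hb, h⟩ := hdec _ _ (e.isValid q (w n))
    exact ⟨b, hb, h.trans (e.winsA_iff q (w n))⟩
  choose b hb hbL using h
  -- The algorithm may diverge on invalid instances, but all instances of the reduction are valid,
  -- so its composition with the reduction is total.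
  have hcomp : Computable b := (hf.comp (e.computable_inst q hw)).of_eq fun n =>
    Part.eq_some_iff.2 (hb n)
  refine hL ((ComputablePred.computable_iff.2 ⟨b, hcomp, rfl⟩ : ComputablePred _).not.of_eq
    fun n => ?_)
  rw [hbL, not_not]

theorem mainTheorem6 :
    (∀ (Q M : Type) [Finite Q] [Finite M] (L : PCS Q M) (QF : Set Q) (q₀ : Q),
      (abtsoGame (simProgram L QF) (simFinal L)).DeadlockFree ∧
      (L.Reaches q₀ QF ↔
        (abtsoGame (simProgram L QF) (simFinal L)).WinsB (Player.B, simInit L q₀))) ∧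
    ¬ ABTSOSafetyDecidable :=
  ⟨fun _ _ _ _ L QF q₀ => ⟨simGame_deadlockFree, reaches_iff_winsB L QF q₀⟩,
    not_ABTSOSafetyDecidable⟩
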